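/- **Theorem 1.1.** Let $H$ be a real Hilbert space and let $A:D(A)\to H$ be a positive self-adjoint linear operator in $H$ with compact inverse. Let $\lambda_1\le\lambda_2\le\cdots$ be the eigenvalues of $A$, counted with multiplicity, and let $\{e_n\}_{n=1}^\infty$ be a corresponding orthonormal basis of $H$ consisting of eigenvectors (in particular, $H$ is infinite-dimensional). Assume that $$L_0:=\sup_{n\in\mathbb N}(\lambda_{n+1}-\lambda_n)<\infty.$$ Then for every $L>\max\{\tfrac12L_0,\lambda_1\}$ there exists a nonlinear operator $F\in C^\infty(H,H)$ such that 1. $F$ is globally Lipschitz on $H$ with Lipschitz constant $L$: $\|F(u)-F(v)\|_H\le L\|u-v\|_H$ for all $u,v\in H$; 2. the equation $\partial_tu+Au=F(u)$, $u|_{t=0}=u_0\in H$, is globally and uniquely solvable, and its solution semigroup $S(t):H\to H$, $t\ge0$, possesses a compact global attractor $\mathcal A$ in $H$, i.e. a compact set $\mathcal A\subset H$ with $S(t)\mathcal A=\mathcal A$ for all $t\ge0$ such that for every bounded $B\subset H$ and every $\varepsilon>0$ the set $S(t)B$ lies in the $\varepsilon$-neighbourhood of $\mathcal A$ for all sufficiently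 large $t$; 3. there is no finite-dimensional invariant $C^1$-submanifold of $H$ containing $\mathcal A$: for no $n\in\{0,1,2,\dots\}$ is there an $n$-dimensional embedded $C^1$-submanifold $\mathcal M\subset H$ with $S(t)\mathcal M\subset\mathcal M$ for all $t\ge0$ and $\mathcal A\subset\mathcal M$. Here a solution is a function $u\in C([0,\infty),H)$ with $u(0)=u_0$ such that $\frac{d}{dt}(u(t),\varphi)+(u(t),A\varphi)=(F(u(t)),\varphi)$ for all $t>0$ and $\varphi\in D(A)$ (equivalently, a mild solution). -/

import Mathlib

open Set Filter Topology
open scoped ContDiff RealInnerProductSpace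

namespace AbstractParabolic

variable {H : Type*} [NormedAddCommGroup H] [InnerProductSpace ℝ H] [CompleteSpace H]

/-- `A : D(A) → H` is an (unbounded, densely defined) self-adjoint operator which is positive and
has a compact inverse. -/
structure IsPositiveWithCompactInverse (A : H →ₗ.[ℝ] H) : Prop where
  isSelfAdjoint : IsSelfAdjoint A
  pos : ∀ x : A.domain, x ≠ 0 → 0 < ⟪A x, (x : H)⟫
  compact_inverse : ∃ K : H →L[ℝ] H, IsCompactOperator K ∧
    (∀ y : H, ∃ x : A.domain, (x : H) = K y ∧ A x = y) ∧ (∀ x : A.domain, K (A x) = x)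

/-- `lam 0 ≤ lam 1 ≤ ⋯` are the eigenvalues of `A`, counted with multiplicity, and `e n` is the
orthonormal basis of `H` made of corresponding eigenvectors. -/
structure IsOrderedEigenbasis (A : H →ₗ.[ℝ] H) (lam : ℕ → ℝ) (e : HilbertBasis ℕ ℝ H) : Prop where
  monotone : Monotone lam
  eigen : ∀ n : ℕ, ∃ x : A.domain, (x : H) = e n ∧ A x = lam n • (x : H)

/-- `u ∈ C([0,∞), H)` solves `∂ₜ u + A u = F(u)`, `u(0) = u₀`. The equation is tested with
the elements of `D(A)`: `d/dt ⟪u, φ⟫ + ⟪u, A φ⟫ = ⟪F(u), φ⟫` for all `t > 0` and `φ ∈ D(A)`.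
For a self-adjoint positive `A` and a continuous `F` these are exactly the mild solutions
`u(t) = exp(-tA) u₀ + ∫₀ᵗ exp(-(t-s)A) F(u(s)) ds`. -/
structure IsSolution (A : H →ₗ.[ℝ] H) (F : H → H) (u₀ : H) (u : ℝ → H) : Prop where
  continuousOn : ContinuousOn u (Ici 0)
  initial : u 0 = u₀
  equation : ∀ φ : A.domain, ∀ t : ℝ, 0 < t →
    HasDerivAt (fun s => ⟪u s, (φ : H)⟫) (⟪F (u t), (φ : H)⟫ - ⟪u t, A φ⟫) t

/-- The Cauchy problem for `∂ₜ u + A u = F(u)` is globally and uniquely solvable in `H`, and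
`S(t) u₀` (for `t ≥ 0`) is the value at time `t` of the solution starting from `u₀`. -/
structure IsSolutionSemigroup (A : H →ₗ.[ℝ] H) (F : H → H) (S : ℝ → H → H) : Prop where
  isSolution : ∀ u₀ : H, IsSolution A F u₀ (fun t => S t u₀)
  unique : ∀ (u₀ : H) (u : ℝ → H), IsSolution A F u₀ u → ∀ t : ℝ, 0 ≤ t → u t = S t u₀

/-- Global attractor of `S(t)`, `t ≥ 0`: a compact, strictly invariant set which attracts the
images of all bounded sets. -/
structure IsGlobalAttractor (S : ℝ → H → H) (𝒜 : Set H) : Prop where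
  isCompact : IsCompact 𝒜
  invariant : ∀ t : ℝ, 0 ≤ t → S t '' 𝒜 = 𝒜
  attracts : ∀ B : Set H, Bornology.IsBounded B → ∀ ε : ℝ, 0 < ε →
    ∃ T : ℝ, 0 ≤ T ∧ ∀ t : ℝ, T ≤ t → S t '' B ⊆ Metric.thickening ε 𝒜

/-- `M ⊆ H` is an `n`-dimensional (embedded) `C¹`-submanifold of `H`: near each of its points it
is the image of an open subset of `ℝⁿ` under a `C¹` immersion which is a homeomorphism onto its
image. -/
def IsC1Submanifold (n : ℕ) (M : Set H) : Prop :=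
  ∀ p ∈ M, ∃ (U : Set H) (O : Set (EuclideanSpace ℝ (Fin n)))
    (ψ : EuclideanSpace ℝ (Fin n) → H),
    IsOpen U ∧ p ∈ U ∧ IsOpen O ∧ ContDiffOn ℝ 1 ψ O ∧
    (∀ x ∈ O, Function.Injective (fderiv ℝ ψ x)) ∧
    IsEmbedding (O.domRestrict ψ) ∧ ψ '' O = M ∩ U

/-- `M` is (forward) invariant under the semigroup: trajectories starting in `M` stay in `M`. -/
def IsInvariantUnder (S : ℝ → H → H) (M : Set H) : Prop :=
  ∀ t : ℝ, 0 ≤ t → S t '' M ⊆ M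

end AbstractParabolic

open AbstractParabolic

set_option linter.unusedSectionVars false

namespace AbstractParabolic

variable {H : Type*} [NormedAddCommGroup H] [InnerProductSpace ℝ H] [CompleteSpace H]

/-! ### Operators given by their action on a Hilbert basis -/

section Basis

variable (e : HilbertBasis ℕ ℝ H)

/-! The obstruction is the parity of the dimension at two equilibria. If an invariant `C¹` manifold
contains an equilibrium `p`, its tangent space at `p` is invariant under the flow of the
linearization `-A + F'(p)`. A finite-dimensional space on which this flow has no real eigenvalue has
even dimension, because a real polynomial of odd degree has a root.

Fix `b` strictly between `max (L₀ / 2) (lam 0)` and `L`, and let `F'(p)` rotate a pair of modes `e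
i`, `e j` with speed `b`. The resulting block has trace `-(lam i + lam j)` and discriminant `(lam i
- lam j)² - 4 b²`, so for neighbouring modes its eigenvalues are not real. At an equilibrium `r • e
0`, all modes are paired as `(0,1), (2,3), …`, which forces even dimension
(`even_of_isC1Submanifold`). At `0`, the pairs are `(1,2), (3,4), …`, and `e 0` is left alone with
growth rate `b - lam 0 > 0`. The segment of the axis near `0` consists of points with bounded
backward orbits, so it lies in the attractor and `e 0` is tangent to the manifold. The part of the
tangent space orthogonal to `e 0` is again even-dimensional, so the total is odd
(`odd_of_isC1Submanifold`). Both equilibria lie in the attractor, so no dimension is possible.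

The nonlinearity with these two derivatives and Lipschitz constant `L` is built in
`exists_nonlinearity`. It is bounded, which together with the compactness of `exp (-tA)` gives the
attractor. Differentiability of the semigroup at an equilibrium is
`IsSolutionSemigroup.hasFDerivAt`; the intrinsic description of the tangent space is
`IsC1Submanifold.exists_tangentSpace`. -/

theorem ext_basis {x y : H} (h : ∀ n, ⟪e n, x⟫ = ⟪e n, y⟫) : x = y := by
  apply e.repr.injective
  ext n
  simpa only [e.repr_apply_apply] using h n

theorem hasSum_sq_inner (x : H) : HasSum (fun n => ⟪e n, x⟫ ^ 2) (‖x‖ ^ 2) := by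
  have h := e.hasSum_inner_mul_inner x x
  rw [real_inner_self_eq_norm_sq] at h
  refine h.congr_fun ?_ 
  intro n
  rw [real_inner_comm x (e n), sq]

/-- Parseval on both sides. The permutation lets the same bound serve diagonal operators and the
rotations that swap modes. -/
theorem norm_le_of_abs_inner_le {C : ℝ} (hC : 0 ≤ C) (π : Equiv.Perm ℕ) {x y : H}
    (h : ∀ n, |⟪e n, y⟫| ≤ C * |⟪e (π n), x⟫|) : ‖y‖ ≤ C * ‖x‖ := by
  have hx : HasSum (fun n => (C * |⟪e (π n), x⟫|) ^ 2) (C ^ 2 * ‖x‖ ^ 2) := by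
    have := ((π.hasSum_iff).2 (hasSum_sq_inner e x)).mul_left (C ^ 2)
    simpa [Function.comp_def, mul_pow, sq_abs] using this
  have := hasSum_le (fun n => by
    have := pow_le_pow_left₀ (abs_nonneg _) (h n) 2
    rwa [sq_abs] at this) (hasSum_sq_inner e y) hx
  rw [← mul_pow] at this
  exact le_of_sq_le_sq this (by positivity)

/-- Weighted permutation operators: `⟪e n, W x⟫ = c n * ⟪e (π n), x⟫`. -/
theorem exists_weightedPerm (π : Equiv.Perm ℕ) (c : ℕ → ℝ) {C : ℝ} (hc : ∀ n, |c n| ≤ C) :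
    ∃ W : H →L[ℝ] H, ∀ x n, ⟪e n, W x⟫ = c n * ⟪e (π n), x⟫ := by
  have hC : 0 ≤ C := (abs_nonneg _).trans (hc 0)
  have hmem : ∀ x : H, Memℓp (fun n => c n * ⟪e (π n), x⟫) 2 := by
    intro x
    refine memℓp_gen ?_
    have hs : Summable fun n => C ^ 2 * ⟪e (π n), x⟫ ^ 2 :=
      ((π.summable_iff).2 (hasSum_sq_inner e x).summable).mul_left (C ^ 2)
    refine Summable.of_nonneg_of_le (fun n => by positivity) (fun n => ?_) hs
    simp only [ENNReal.toReal_ofNat, Real.rpow_ofNat, Real.norm_eq_abs, sq_abs, mul_pow]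
    exact mul_le_mul_of_nonneg_right (sq_le_sq.2 ((hc n).trans (le_abs_self C))) (sq_nonneg _)
  let W₀ : H →ₗ[ℝ] H :=
    { toFun := fun x => e.repr.symm ⟨_, hmem x⟩
      map_add' := fun x y => by
        rw [← map_add]; congr 1; ext n
        rw [lp.coeFn_add]; simp [inner_add_right, mul_add]
      map_smul' := fun a x => by
        rw [RingHom.id_apply, ← map_smul]; congr 1; ext n
        simp [inner_smul_right, mul_left_comm] }
  have hW : ∀ x n, ⟪e n, W₀ x⟫ = c n * ⟪e (π n), x⟫ := by
    intro x n
    rw [← e.repr_apply_apply]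
    simp [W₀]
  refine ⟨W₀.mkContinuous C fun x => norm_le_of_abs_inner_le e hC π fun n => ?_, hW⟩
  rw [hW, abs_mul]
  gcongr
  exact hc n

theorem exists_diagonal (c : ℕ → ℝ) {C : ℝ} (hc : ∀ n, |c n| ≤ C) :
    ∃ W : H →L[ℝ] H, ∀ x n, ⟪e n, W x⟫ = c n * ⟪e n, x⟫ :=
  exists_weightedPerm e (Equiv.refl ℕ) c hc

end Basis

/-- `E` is the semigroup `exp (-tA)` extended by the identity to `t < 0`. -/
def IsHeat (lam : ℕ → ℝ) (e : HilbertBasis ℕ ℝ H) (E : ℝ → H →L[ℝ] H) : Prop :=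
  ∀ t x n, ⟪e n, E t x⟫ = Real.exp (-lam n * max t 0) * ⟪e n, x⟫

/-! ### The semigroup `exp (-tA)`. -/

section Heat

variable {lam : ℕ → ℝ} {e : HilbertBasis ℕ ℝ H} {E : ℝ → H →L[ℝ] H}

theorem exists_isHeat (e : HilbertBasis ℕ ℝ H) (hpos : ∀ n, 0 < lam n) :
    ∃ E : ℝ → H →L[ℝ] H, IsHeat lam e E := by
  have : ∀ t : ℝ, ∃ W : H →L[ℝ] H, ∀ x n,
      ⟪e n, W x⟫ = Real.exp (-lam n * max t 0) * ⟪e n, x⟫ := fun t =>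
    exists_diagonal e (C := 1) _ fun n => by
      rw [abs_of_pos (Real.exp_pos _), Real.exp_le_one_iff, neg_mul, neg_nonpos]
      exact mul_nonneg (hpos n).le (le_max_right _ _)
  choose E hE using this
  exact ⟨E, hE⟩

theorem IsHeat.norm_le (hE : IsHeat lam e E) (hmono : Monotone lam) {t : ℝ} (ht : 0 ≤ t) (x : H) :
    ‖E t x‖ ≤ Real.exp (-lam 0 * t) * ‖x‖ := by
  refine norm_le_of_abs_inner_le e (Real.exp_pos _).le (Equiv.refl ℕ) fun n => ?_
  rw [hE, abs_mul, abs_of_pos (Real.exp_pos _), max_eq_left ht]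
  simp only [Equiv.refl_apply]
  gcongr
  exact hmono (Nat.zero_le n)

theorem IsHeat.norm_le_self (hE : IsHeat lam e E) (hpos : ∀ n, 0 < lam n) (t : ℝ) (x : H) :
    ‖E t x‖ ≤ ‖x‖ := by
  rw [← one_mul ‖x‖]
  refine norm_le_of_abs_inner_le e zero_le_one (Equiv.refl ℕ) fun n => ?_
  rw [hE, abs_mul, abs_of_pos (Real.exp_pos _)]
  simp only [Equiv.refl_apply]
  gcongr
  rw [Real.exp_le_one_iff, neg_mul, neg_nonpos]
  exact mul_nonneg (hpos n).le (le_max_right _ _)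

theorem IsHeat.apply_basis (hE : IsHeat lam e E) (t : ℝ) (n : ℕ) :
    E t (e n) = Real.exp (-lam n * max t 0) • e n := by
  refine ext_basis e fun m => ?_
  rw [hE, inner_smul_right]
  rcases eq_or_ne m n with rfl | h
  · rfl
  · rw [e.orthonormal.2 h]; simp

theorem IsHeat.zero (hE : IsHeat lam e E) (x : H) : E 0 x = x :=
  ext_basis e fun m => by rw [hE]; simp

theorem IsHeat.add (hE : IsHeat lam e E) {s t : ℝ} (hs : 0 ≤ s) (ht : 0 ≤ t) (x : H) :
    E (s + t) x = E s (E t x) :=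
  ext_basis e fun m => by
    rw [hE, hE, hE, max_eq_left hs, max_eq_left ht, max_eq_left (add_nonneg hs ht), ← mul_assoc,
      ← Real.exp_add, mul_add]

/-- Continuity in time is clear on finite combinations of eigenvectors. Density and the uniform
Lipschitz constant `1` give joint continuity. -/
theorem IsHeat.continuous (hE : IsHeat lam e E) (hpos : ∀ n, 0 < lam n) :
    Continuous fun p : H × ℝ => E p.2 p.1 := by
  refine continuous_prod_of_dense_continuous_lipschitzWith _ 1
    (s := (Submodule.span ℝ (range e) : Set H)) ?_ ?_ ?_
  · have := e.dense_span
    rwa [← Submodule.dense_iff_topologicalClosure_eq_top] at this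
  · intro x hx
    induction hx using Submodule.span_induction with
    | mem x h =>
      obtain ⟨n, rfl⟩ := h
      simp only [hE.apply_basis]
      fun_prop
    | zero => simpa using continuous_const
    | add x y _ _ hx hy => simpa [Pi.add_def] using hx.add hy
    | smul a x _ hx => simpa [Pi.smul_def] using hx.const_smul a
  · intro t
    refine LipschitzWith.of_dist_le_mul fun x y => ?_
    rw [dist_eq_norm, dist_eq_norm, ← map_sub, NNReal.coe_one, one_mul]
    exact hE.norm_le_self hpos t _

theorem IsHeat.continuous_comp (hE : IsHeat lam e E) (hpos : ∀ n, 0 < lam n) {X : Type*}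
    [TopologicalSpace X] {f : X → ℝ} {g : X → H} (hf : Continuous f) (hg : Continuous g) :
    Continuous fun x => E (f x) (g x) :=
  (hE.continuous hpos).comp (hg.prodMk hf)

end Heat

/-- The properties of `A` used below, in terms of the inverse `K` and of the eigenbasis. -/
structure IsSpectral (A : H →ₗ.[ℝ] H) (lam : ℕ → ℝ) (e : HilbertBasis ℕ ℝ H) (K : H →L[ℝ] H) :
    Prop where
  monotone : Monotone lam
  pos : ∀ n, 0 < lam n
  eigen : ∀ n : ℕ, ∃ x : A.domain, (x : H) = e n ∧ A x = lam n • e n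
  compact : IsCompactOperator K
  inverse : ∀ x : A.domain, K (A x) = x
  diagonal : ∀ x n, ⟪e n, K x⟫ = (lam n)⁻¹ * ⟪e n, x⟫

theorem exists_isSpectral {A : H →ₗ.[ℝ] H} (hA : IsPositiveWithCompactInverse A)
    {lam : ℕ → ℝ} {e : HilbertBasis ℕ ℝ H} (he : IsOrderedEigenbasis A lam e) :
    ∃ K : H →L[ℝ] H, IsSpectral A lam e K := by
  obtain ⟨K, hK, -, hKA⟩ := hA.compact_inverse
  have hpos : ∀ n, 0 < lam n := by
    intro n
    obtain ⟨x, hx, hAx⟩ := he.eigen n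
    have hx0 : x ≠ 0 := by
      rintro rfl
      have := e.orthonormal.1 n
      rw [← hx] at this
      simp at this
    have := hA.pos x hx0
    rw [hAx, hx, inner_smul_left, real_inner_self_eq_norm_sq, e.orthonormal.1 n] at this
    simpa using this
  have heig : ∀ n : ℕ, ∃ x : A.domain, (x : H) = e n ∧ A x = lam n • e n := fun n => by
    obtain ⟨x, hx, hAx⟩ := he.eigen n
    exact ⟨x, hx, by rw [hAx, hx]⟩
  have hKe : ∀ n, K (e n) = (lam n)⁻¹ • e n := by
    intro n
    obtain ⟨x, hx, hAx⟩ := heig n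
    have := hKA x
    rw [hAx, hx, map_smul] at this
    rw [← this, smul_smul, inv_mul_cancel₀ (hpos n).ne', one_smul, ← hx]
    rw [hx, this]
  obtain ⟨D, hD⟩ := exists_diagonal e (fun n => (lam n)⁻¹) (C := (lam 0)⁻¹) fun n => by
    rw [abs_of_pos (inv_pos.2 (hpos n))]
    exact inv_anti₀ (hpos 0) (he.monotone (Nat.zero_le n))
  have hKD : K = D := by
    refine ContinuousLinearMap.ext_on (s := range e) ?_ ?_
    · have := e.dense_span
      rwa [← Submodule.dense_iff_topologicalClosure_eq_top] at this
    · rintro _ ⟨n, rfl⟩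
      rw [hKe]
      refine ext_basis e fun m => ?_
      rw [hD, inner_smul_right]
      rcases eq_or_ne m n with rfl | h
      · rfl
      · rw [e.orthonormal.2 h]; simp
  exact ⟨K, he.monotone, hpos, heig, hK, hKA, fun x n => by rw [hKD, hD]⟩

section Spectral

variable {A : H →ₗ.[ℝ] H} {lam : ℕ → ℝ} {e : HilbertBasis ℕ ℝ H} {K : H →L[ℝ] H}
  {E : ℝ → H →L[ℝ] H}

theorem IsSpectral.symm (hK : IsSpectral A lam e K) (x y : H) : ⟪K x, y⟫ = ⟪x, K y⟫ := by
  refine (e.hasSum_inner_mul_inner (K x) y).unique ?_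
  refine (e.hasSum_inner_mul_inner x (K y)).congr_fun fun n => ?_
  rw [hK.diagonal, real_inner_comm _ (K x), hK.diagonal, real_inner_comm]
  ring

/-- `exp (-tA) = K ∘ (A exp (-tA))`, and the second factor is bounded by `1 / t` because `x * exp
(-x) ≤ 1`. -/
theorem IsSpectral.isCompactOperator_heat (hK : IsSpectral A lam e K) (hE : IsHeat lam e E)
    {t : ℝ} (ht : 0 < t) : IsCompactOperator (E t) := by
  obtain ⟨D, hD⟩ := exists_diagonal e (fun n => lam n * Real.exp (-lam n * t)) (C := 1 / t)
    fun n => by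
      have h1 := mul_pos (hK.pos n) ht
      have h2 : lam n * t * Real.exp (-lam n * t) ≤ 1 := by
        rw [neg_mul, Real.exp_neg, ← div_eq_mul_inv, div_le_one (Real.exp_pos _)]
        linarith [Real.add_one_le_exp (lam n * t)]
      rw [abs_of_pos (mul_pos (hK.pos n) (Real.exp_pos _)), le_div_iff₀ ht]
      linarith
  have : (E t : H → H) = K ∘ D := by
    funext x
    refine ext_basis e fun n => ?_
    rw [hE, Function.comp_apply, hK.diagonal, hD, max_eq_left ht.le, ← mul_assoc, ← mul_assoc,
      inv_mul_cancel₀ (hK.pos n).ne', one_mul]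
  rw [this]
  exact hK.compact.comp_clm D

end Spectral

/-! ### Weak and mild solutions -/

/-- `u(t) = exp(-tA) u₀ + ∫₀ᵗ exp(-(t-s)A) F(u(s)) ds` for `t ≥ 0`, with `u` continuous. -/
structure IsMild (E : ℝ → H →L[ℝ] H) (F : H → H) (u₀ : H) (u : ℝ → H) : Prop where
  continuousOn : ContinuousOn u (Ici 0)
  formula : ∀ t, 0 ≤ t → u t = E t u₀ + ∫ s in (0 : ℝ)..t, E (t - s) (F (u s))

theorem variation_of_constants {y f : ℝ → ℝ} {l : ℝ} (hy : Continuous y) (hf : Continuous f)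
    (h : ∀ t, 0 < t → HasDerivAt y (f t - l * y t) t) {t : ℝ} (ht : 0 ≤ t) :
    y t = Real.exp (-l * t) * y 0 + ∫ s in (0 : ℝ)..t, Real.exp (-l * (t - s)) * f s := by
  have hd : ∀ s ∈ Ioo 0 t,
      HasDerivAt (fun s => Real.exp (-l * (t - s)) * y s) (Real.exp (-l * (t - s)) * f s) s := by
    intro s hs
    have h1 : HasDerivAt (fun s => Real.exp (-l * (t - s))) (Real.exp (-l * (t - s)) * l) s := by
      have := (((hasDerivAt_id s).const_sub t).const_mul (-l)).exp
      simpa using this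
    exact (h1.mul (h s hs.1)).congr_deriv (by ring)
  have := intervalIntegral.integral_eq_sub_of_hasDerivAt_of_le ht
    (Continuous.continuousOn (by fun_prop)) hd (Continuous.intervalIntegrable (by fun_prop) _ _)
  rw [this]
  simp

theorem hasDerivAt_of_variation_of_constants {y f : ℝ → ℝ} {l y₀ : ℝ} (hf : Continuous f)
    (h : ∀ t, 0 ≤ t →
      y t = Real.exp (-l * t) * y₀ + ∫ s in (0 : ℝ)..t, Real.exp (-l * (t - s)) * f s)
    {t : ℝ} (ht : 0 < t) : HasDerivAt y (f t - l * y t) t := by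
  have heq : ∀ t, 0 ≤ t →
      y t = Real.exp (-l * t) * (y₀ + ∫ s in (0 : ℝ)..t, Real.exp (l * s) * f s) := by
    intro t ht
    rw [h t ht, mul_add, ← intervalIntegral.integral_const_mul]
    congr 1
    refine intervalIntegral.integral_congr fun s _ => ?_
    rw [← mul_assoc, ← Real.exp_add]
    ring_nf
  have h1 : HasDerivAt (fun t => Real.exp (-l * t)) (Real.exp (-l * t) * (-l)) t := by
    simpa using ((hasDerivAt_id t).const_mul (-l)).exp
  have h2 : HasDerivAt (fun t => y₀ + ∫ s in (0 : ℝ)..t, Real.exp (l * s) * f s)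
      (Real.exp (l * t) * f t) t :=
    ((Continuous.integral_hasStrictDerivAt (by fun_prop) 0 t).hasDerivAt).const_add y₀
  refine ((h1.mul h2).congr_of_eventuallyEq ?_).congr_deriv ?_
  · filter_upwards [lt_mem_nhds ht] with s hs using heq s hs.le
  · rw [heq t ht.le, ← mul_assoc (Real.exp (-l * t)) (Real.exp (l * t)), ← Real.exp_add]
    simp
    ring

/-- Freezing a solution for negative times makes it continuous on all of `ℝ`, so that the
fundamental theorem of calculus applies without endpoint conditions. -/
theorem continuous_comp_max {u : ℝ → H} (hu : ContinuousOn u (Ici 0)) :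
    Continuous fun t => u (max t 0) :=
  hu.comp_continuous (by fun_prop) fun t => le_max_right t 0

section Mild

variable {A : H →ₗ.[ℝ] H} {lam : ℕ → ℝ} {e : HilbertBasis ℕ ℝ H} {K : H →L[ℝ] H}
  {E : ℝ → H →L[ℝ] H} {F : H → H} {u₀ : H} {u : ℝ → H}

theorem integral_comp_max {g : ℝ → ℝ → H → H} {u : ℝ → H} {t : ℝ} (ht : 0 ≤ t) :
    ∫ s in (0 : ℝ)..t, g t s (u (max s 0)) = ∫ s in (0 : ℝ)..t, g t s (u s) := by
  refine intervalIntegral.integral_congr fun s hs => ?_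
  rw [uIcc_of_le ht] at hs
  simp only [max_eq_left hs.1]

theorem IsMild.comp_max (h : IsMild E F u₀ u) : IsMild E F u₀ fun t => u (max t 0) :=
  ⟨(continuous_comp_max h.continuousOn).continuousOn, fun t ht => by
    rw [integral_comp_max (g := fun t s x => E (t - s) (F x)) ht, max_eq_left ht,
      ← h.formula t ht]⟩

theorem IsSolution.comp_max (h : IsSolution A F u₀ u) :
    IsSolution A F u₀ fun t => u (max t 0) where
  continuousOn := (continuous_comp_max h.continuousOn).continuousOn
  initial := by rw [max_self, h.initial]
  equation φ t ht := by
    simp only [max_eq_left ht.le]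
    refine (h.equation φ t ht).congr_of_eventuallyEq ?_
    filter_upwards [lt_mem_nhds ht] with s hs
    rw [max_eq_left hs.le]

theorem IsHeat.inner_integral (hE : IsHeat lam e E) (hpos : ∀ n, 0 < lam n) {f : ℝ → H}
    (hf : Continuous f) {t : ℝ} (ht : 0 ≤ t) (n : ℕ) :
    ⟪e n, ∫ s in (0 : ℝ)..t, E (t - s) (f s)⟫ =
      ∫ s in (0 : ℝ)..t, Real.exp (-lam n * (t - s)) * ⟪e n, f s⟫ := by
  have hc : Continuous fun s => E (t - s) (f s) := hE.continuous_comp hpos (by fun_prop) hf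
  have := (innerSL ℝ (e n)).intervalIntegral_comp_comm (μ := MeasureTheory.volume)
    (hc.intervalIntegrable 0 t)
  simp only [innerSL_apply_apply] at this
  rw [← this]
  refine intervalIntegral.integral_congr fun s hs => ?_
  rw [uIcc_of_le ht] at hs
  simp only [hE (t - s), max_eq_left (sub_nonneg.2 hs.2)]

theorem IsSolution.hasDerivAt_inner_basis (hK : IsSpectral A lam e K) (h : IsSolution A F u₀ u)
    (n : ℕ) {t : ℝ} (ht : 0 < t) :
    HasDerivAt (fun s => ⟪e n, u s⟫) (⟪e n, F (u t)⟫ - lam n * ⟪e n, u t⟫) t := by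
  obtain ⟨x, hx, hAx⟩ := hK.eigen n
  have := h.equation x t ht
  rw [hAx, hx, inner_smul_right] at this
  simpa only [real_inner_comm (e n)] using this

/-- Testing with eigenvectors turns the equation into scalar linear equations, which are solved
coordinatewise by variation of constants. -/
theorem IsSolution.isMild (hK : IsSpectral A lam e K) (hE : IsHeat lam e E) (hF : Continuous F)
    (h : IsSolution A F u₀ u) : IsMild E F u₀ u := by
  refine ⟨h.continuousOn, fun t ht => ?_⟩
  have hc := continuous_comp_max h.continuousOn
  have h' := h.comp_max
  rw [← integral_comp_max (g := fun t s x => E (t - s) (F x)) ht]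
  refine ext_basis e fun n => ?_
  rw [inner_add_right, hE.inner_integral hK.pos (f := fun s => F (u (max s 0)))
    (hF.comp hc) ht, hE, max_eq_left ht]
  have := variation_of_constants (y := fun s => ⟪e n, u (max s 0)⟫)
    (f := fun s => ⟪e n, F (u (max s 0))⟫) (continuous_const.inner hc)
    (continuous_const.inner (hF.comp hc))
    (fun t ht => h'.hasDerivAt_inner_basis hK n ht) ht
  simpa [max_eq_left ht, h.initial] using this

/-- A mild solution need not be differentiable in `H`, but `K u` is, with derivative `K (F u) - u`.
Pairing this with `A φ` gives the weak equation, since `K` is symmetric and `K (A φ) = φ`. -/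
theorem IsMild.isSolution (hK : IsSpectral A lam e K) (hE : IsHeat lam e E) (hF : Continuous F)
    (h : IsMild E F u₀ u) : IsSolution A F u₀ u := by
  have hc := continuous_comp_max h.continuousOn
  have h' := h.comp_max
  have hu0 : u 0 = u₀ := by simpa [hE.zero] using h.formula 0 le_rfl
  refine ⟨h.continuousOn, hu0, fun φ t ht => ?_⟩
  set v : ℝ → H := fun t => u (max t 0) with hv
  have hint : ∀ t, 0 ≤ t → K (v t) = K u₀ + ∫ s in (0 : ℝ)..t, (K (F (v s)) - v s) := by
    intro t ht
    refine ext_basis e fun n => ?_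
    have hg : Continuous fun s => K (F (v s)) - v s := by fun_prop
    have hi := (innerSL ℝ (e n)).intervalIntegral_comp_comm (μ := MeasureTheory.volume)
      (hg.intervalIntegrable 0 t)
    simp only [innerSL_apply_apply] at hi
    have hd : ∀ s ∈ Ioo 0 t,
        HasDerivAt (fun s => ⟪e n, K (v s)⟫) ⟪e n, K (F (v s)) - v s⟫ s := by
      intro s hs
      have := hasDerivAt_of_variation_of_constants (y := fun s => ⟪e n, v s⟫)
        (f := fun s => ⟪e n, F (v s)⟫) (l := lam n) (y₀ := ⟪e n, u₀⟫) (by fun_prop) (fun t ht => by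
          rw [h'.formula t ht, inner_add_right, hE.inner_integral hK.pos (f := fun s => F (v s))
            (hF.comp hc) ht, hE, max_eq_left ht]) hs.1
      simp only [hK.diagonal, inner_sub_right]
      refine (this.const_mul (lam n)⁻¹).congr_deriv ?_
      rw [mul_sub, inv_mul_cancel_left₀ (hK.pos n).ne']
    rw [inner_add_right, ← hi, intervalIntegral.integral_eq_sub_of_hasDerivAt_of_le ht
      (Continuous.continuousOn (by fun_prop)) hd (Continuous.intervalIntegrable (by fun_prop) _ _)]
    simp [hv, hu0]
  have hder : HasDerivAt (fun s => K (v s)) (K (F (v t)) - v t) t := by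
    have := (Continuous.integral_hasStrictDerivAt (f := fun s => K (F (v s)) - v s)
      (by fun_prop) 0 t).hasDerivAt.const_add (K u₀)
    refine this.congr_of_eventuallyEq ?_
    filter_upwards [lt_mem_nhds ht] with s hs using hint s hs.le
  have hvt : v t = u t := by simp [hv, max_eq_left ht.le]
  have := hder.inner ℝ (hasDerivAt_const t (A φ))
  simp only [hK.symm, inner_zero_right, map_zero, zero_add, inner_sub_left, hK.inverse, hvt] at this
  refine this.congr_of_eventuallyEq ?_
  filter_upwards [lt_mem_nhds ht] with s hs
  simp [hv, max_eq_left hs.le]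

end Mild

/-! ### Existence and stability of mild solutions -/

theorem norm_integral_le_exp {f : ℝ → H} {C κ t : ℝ} (hκ : 0 < κ) (ht : 0 ≤ t)
    (h : ∀ s, 0 ≤ s → s ≤ t → ‖f s‖ ≤ C * Real.exp (κ * s)) :
    ‖∫ s in (0 : ℝ)..t, f s‖ ≤ C * ((Real.exp (κ * t) - 1) / κ) := by
  have h1 := intervalIntegral.norm_integral_le_of_norm_le (μ := MeasureTheory.volume) (f := f)
    (g := fun s => C * Real.exp (κ * s)) ht
    (Eventually.of_forall fun s hs => h s hs.1.le hs.2)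
    (Continuous.intervalIntegrable (by fun_prop) _ _)
  refine h1.trans_eq ?_
  have hd : ∀ s ∈ uIcc 0 t, HasDerivAt (fun s => C * (Real.exp (κ * s) / κ))
      (C * Real.exp (κ * s)) s := by
    intro s _
    have := ((((hasDerivAt_id s).const_mul κ).exp).div_const κ).const_mul C
    refine this.congr_deriv ?_
    simp only [id, mul_one]
    field_simp
  rw [intervalIntegral.integral_eq_sub_of_hasDerivAt hd
    (Continuous.intervalIntegrable (by fun_prop) _ _)]
  simp
  ring

section Mild

variable {A : H →ₗ.[ℝ] H} {lam : ℕ → ℝ} {e : HilbertBasis ℕ ℝ H} {K : H →L[ℝ] H}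
  {E : ℝ → H →L[ℝ] H} {F G : H → H} {u₀ v₀ : H} {u v : ℝ → H} {L : ℝ}

theorem continuous_of_norm_sub_le (hF : ∀ u v : H, ‖F u - F v‖ ≤ L * ‖u - v‖) : Continuous F := by
  refine (LipschitzWith.of_dist_le_mul (K := L.toNNReal) fun u v => ?_).continuous
  rw [dist_eq_norm, dist_eq_norm]
  exact (hF u v).trans (by gcongr; exact Real.le_coe_toNNReal L)

/-- The mild solution operator acting on `s ↦ exp (-κ s) u(s)`. -/
theorem IsHeat.exists_duhamel (hE : IsHeat lam e E) (hpos : ∀ n, 0 < lam n) (hL : 0 < L)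
    (hF : ∀ u v : H, ‖F u - F v‖ ≤ L * ‖u - v‖) (u₀ : H) :
    ∃ Φ : BoundedContinuousFunction ℝ H → BoundedContinuousFunction ℝ H, ∀ v t,
      Φ v t = Real.exp (-(2 * L) * max t 0) • (E t u₀ +
        ∫ s in (0 : ℝ)..max t 0, E (max t 0 - s) (F (Real.exp (2 * L * s) • v s))) := by
  have hFc := continuous_of_norm_sub_le hF
  have key : ∀ v : BoundedContinuousFunction ℝ H, ∃ w : BoundedContinuousFunction ℝ H, ∀ t,
      w t = Real.exp (-(2 * L) * max t 0) • (E t u₀ +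
        ∫ s in (0 : ℝ)..max t 0, E (max t 0 - s) (F (Real.exp (2 * L * s) • v s))) := by
    intro v
    have hvc : Continuous fun s => F (Real.exp (2 * L * s) • v s) := by fun_prop
    refine ⟨BoundedContinuousFunction.ofNormedAddCommGroup _ ?_
      (‖u₀‖ + (‖F 0‖ + L * ‖v‖) / (2 * L)) ?_, fun t => rfl⟩
    · refine Continuous.smul (by fun_prop) (Continuous.add ?_ ?_)
      · exact hE.continuous_comp hpos continuous_id continuous_const
      · refine intervalIntegral.continuous_parametric_intervalIntegral_of_continuous
          (f := fun t s => E (max t 0 - s) (F (Real.exp (2 * L * s) • v s))) ?_ (by fun_prop)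
        exact hE.continuous_comp hpos (by fun_prop) (hvc.comp continuous_snd)
    · intro t
      change ‖Real.exp (-(2 * L) * max t 0) • (_ : H)‖ ≤ _
      rw [norm_smul, Real.norm_eq_abs, abs_of_pos (Real.exp_pos _)]
      have ht : 0 ≤ max t 0 := le_max_right _ _
      set τ := max t 0
      have hi := norm_integral_le_exp (f := fun s => E (τ - s) (F (Real.exp (2 * L * s) • v s)))
        (C := ‖F 0‖ + L * ‖v‖) (κ := 2 * L) (by positivity) ht (fun s hs0 hs => by
          refine (hE.norm_le_self hpos _ _).trans ?_
          have h1 := hF (Real.exp (2 * L * s) • v s) 0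
          have h2 : ‖F (Real.exp (2 * L * s) • v s)‖ ≤
              ‖F 0‖ + ‖F (Real.exp (2 * L * s) • v s) - F 0‖ := by
            simpa using norm_add_le (F 0) (F (Real.exp (2 * L * s) • v s) - F 0)
          rw [sub_zero, norm_smul, Real.norm_eq_abs, abs_of_pos (Real.exp_pos _)] at h1
          have h3 : 1 ≤ Real.exp (2 * L * s) := Real.one_le_exp (by positivity)
          have h4 : L * (Real.exp (2 * L * s) * ‖v s‖) ≤ L * (Real.exp (2 * L * s) * ‖v‖) := by
            gcongr; exact v.norm_coe_le_norm s
          nlinarith [norm_nonneg (F 0)])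
      have h5 : Real.exp (-(2 * L) * τ) ≤ 1 := Real.exp_le_one_iff.2 (by
        rw [neg_mul, neg_nonpos]; positivity)
      have h6 : Real.exp (-(2 * L) * τ) * Real.exp (2 * L * τ) = 1 := by
        rw [← Real.exp_add]; simp
      calc _ ≤ Real.exp (-(2 * L) * τ) * (‖u₀‖ +
            (‖F 0‖ + L * ‖v‖) * ((Real.exp (2 * L * τ) - 1) / (2 * L))) := by
            gcongr
            exact (norm_add_le _ _).trans (add_le_add (hE.norm_le_self hpos _ _) hi)
        _ = Real.exp (-(2 * L) * τ) * ‖u₀‖ + (‖F 0‖ + L * ‖v‖) / (2 * L) *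
            (Real.exp (-(2 * L) * τ) * Real.exp (2 * L * τ) - Real.exp (-(2 * L) * τ)) := by ring
        _ ≤ 1 * ‖u₀‖ + (‖F 0‖ + L * ‖v‖) / (2 * L) * 1 := by
            rw [h6]
            gcongr
            linarith [Real.exp_pos (-(2 * L) * τ)]
        _ = _ := by ring
  choose Φ hΦ using key
  exact ⟨Φ, hΦ⟩

theorem IsHeat.exists_isMild (hE : IsHeat lam e E) (hpos : ∀ n, 0 < lam n) (hL : 0 < L)
    (hF : ∀ u v : H, ‖F u - F v‖ ≤ L * ‖u - v‖) (u₀ : H) : ∃ u : ℝ → H, IsMild E F u₀ u := by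
  have hFc := continuous_of_norm_sub_le hF
  obtain ⟨Φ, hΦ⟩ := hE.exists_duhamel hpos hL hF u₀
  -- The weight `exp (-2Lt)` makes the Duhamel map a contraction on the whole half-line: the factor
  -- is at most `∫ L exp (-2L(t-s)) ds ≤ 1 / 2`.
  have hcontr : ContractingWith (1 / 2) Φ := by
    refine ⟨by
      rw [← NNReal.coe_lt_coe]; norm_num, LipschitzWith.of_dist_le_mul fun v w => ?_⟩
    refine (BoundedContinuousFunction.dist_le (by positivity)).2 fun t => ?_
    rw [hΦ, hΦ, dist_eq_norm, ← smul_sub, add_sub_add_left_eq_sub, norm_smul, Real.norm_eq_abs,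
      abs_of_pos (Real.exp_pos _)]
    have ht : 0 ≤ max t 0 := le_max_right _ _
    set τ := max t 0
    have hint : ∀ v : BoundedContinuousFunction ℝ H, IntervalIntegrable
        (fun s => E (τ - s) (F (Real.exp (2 * L * s) • v s))) MeasureTheory.volume 0 τ :=
      fun v => (hE.continuous_comp hpos (by fun_prop) (by fun_prop)).intervalIntegrable _ _
    rw [← intervalIntegral.integral_sub (hint v) (hint w)]
    have hi := norm_integral_le_exp
      (f := fun s => E (τ - s) (F (Real.exp (2 * L * s) • v s)) -
        E (τ - s) (F (Real.exp (2 * L * s) • w s)))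
      (C := L * dist v w) (κ := 2 * L) (by positivity) ht (fun s hs0 hs => by
        rw [← map_sub]
        refine (hE.norm_le_self hpos _ _).trans ((hF _ _).trans ?_)
        rw [← smul_sub, norm_smul, Real.norm_eq_abs, abs_of_pos (Real.exp_pos _), ← dist_eq_norm]
        have := BoundedContinuousFunction.dist_coe_le_dist (f := v) (g := w) s
        calc L * (Real.exp (2 * L * s) * dist (v s) (w s))
            ≤ L * (Real.exp (2 * L * s) * dist v w) := by gcongr
          _ = _ := by ring)
    have h6 : Real.exp (-(2 * L) * τ) * Real.exp (2 * L * τ) = 1 := by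
      rw [← Real.exp_add]; simp
    calc _ ≤ Real.exp (-(2 * L) * τ) * (L * dist v w * ((Real.exp (2 * L * τ) - 1) / (2 * L))) := by
          gcongr
      _ = dist v w / 2 * (Real.exp (-(2 * L) * τ) * Real.exp (2 * L * τ) -
          Real.exp (-(2 * L) * τ)) := by field_simp
      _ ≤ dist v w / 2 * 1 := by
          rw [h6]
          gcongr
          linarith [Real.exp_pos (-(2 * L) * τ)]
      _ = _ := by simp; ring
  set v := hcontr.fixedPoint
  have hv : Φ v = v := hcontr.fixedPoint_isFixedPt
  refine ⟨fun t => Real.exp (2 * L * t) • v t, Continuous.continuousOn (by fun_prop),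
    fun t ht => ?_⟩
  have h6 : Real.exp (2 * L * t) * Real.exp (-(2 * L) * t) = 1 := by
    rw [← Real.exp_add]; simp
  conv_lhs => rw [← hv, hΦ, max_eq_left ht, smul_smul, h6, one_smul]

/-- A Gronwall estimate for two different nonlinearities that only need to be compared along the two
solutions. With `ε = 0` it gives uniqueness and Lipschitz dependence, and also the explicit flow on
the axis; with small `ε` it gives the linearization. -/
theorem IsMild.norm_sub_le (hE : IsHeat lam e E) (hpos : ∀ n, 0 < lam n) (hL : 0 ≤ L)
    (hF : Continuous F) (hG : Continuous G) (hu : IsMild E F u₀ u) (hv : IsMild E G v₀ v)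
    {ε T : ℝ} (hε : 0 ≤ ε)
    (h : ∀ s, 0 ≤ s → s ≤ T → ‖F (u s) - G (v s)‖ ≤ ε + L * ‖u s - v s‖)
    {t : ℝ} (ht : 0 ≤ t) (htT : t ≤ T) :
    ‖u t - v t‖ ≤ (‖u₀ - v₀‖ + ε * T) * Real.exp (L * t) := by
  have huc := continuous_comp_max hu.continuousOn
  have hvc := continuous_comp_max hv.continuousOn
  set a := ‖u₀ - v₀‖ + ε * T with ha
  have hT : 0 ≤ T := ht.trans htT
  have ha0 : 0 ≤ a := by positivity
  set d : ℝ → ℝ := fun t => ‖u (max t 0) - v (max t 0)‖ with hd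
  have hdc : Continuous d := (huc.sub hvc).norm
  have hmain : ∀ t, 0 ≤ t → t ≤ T → d t ≤ a + L * ∫ s in (0 : ℝ)..t, d s := by
    intro t ht htT
    have h1 := hu.comp_max.formula t ht
    have h2 := hv.comp_max.formula t ht
    have hi : IntervalIntegrable (fun s => E (t - s) (F (u (max s 0)))) MeasureTheory.volume 0 t :=
      (hE.continuous_comp hpos (by fun_prop) (hF.comp huc)).intervalIntegrable _ _
    have hj : IntervalIntegrable (fun s => E (t - s) (G (v (max s 0)))) MeasureTheory.volume 0 t :=
      (hE.continuous_comp hpos (by fun_prop) (hG.comp hvc)).intervalIntegrable _ _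
    have h3 := intervalIntegral.norm_integral_le_of_norm_le (μ := MeasureTheory.volume)
      (f := fun s => E (t - s) (F (u (max s 0))) - E (t - s) (G (v (max s 0))))
      (g := fun s => ε + L * d s) ht (Eventually.of_forall fun s hs => by
        rw [← map_sub]
        refine (hE.norm_le_self hpos _ _).trans ?_
        simp only [hd, max_eq_left hs.1.le]
        exact h s hs.1.le (hs.2.trans htT))
      (Continuous.intervalIntegrable (by fun_prop) _ _)
    rw [intervalIntegral.integral_sub hi hj, intervalIntegral.integral_add
      (Continuous.intervalIntegrable (by fun_prop) _ _)
      (Continuous.intervalIntegrable (by fun_prop) _ _),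
      intervalIntegral.integral_const, intervalIntegral.integral_const_mul, sub_zero,
      smul_eq_mul] at h3
    have h4 := hE.norm_le_self hpos t (u₀ - v₀)
    rw [map_sub] at h4
    have h5 : t * ε ≤ ε * T := by nlinarith
    calc d t = ‖(E t u₀ - E t v₀) + ((∫ s in (0 : ℝ)..t, E (t - s) (F (u (max s 0)))) -
          ∫ s in (0 : ℝ)..t, E (t - s) (G (v (max s 0))))‖ := by
          rw [hd]; beta_reduce; rw [h1, h2]; congr 1; abel
      _ ≤ _ := (norm_add_le _ _).trans (by linarith)
  have hint0 : ∀ t, 0 ≤ t → 0 ≤ ∫ s in (0 : ℝ)..t, d s := fun t ht =>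
    intervalIntegral.integral_nonneg ht fun s _ => norm_nonneg _
  have hderiv : ∀ t, HasDerivAt (fun t => a + L * ∫ s in (0 : ℝ)..t, d s) (L * d t) t := fun t =>
    ((hdc.integral_hasStrictDerivAt 0 t).hasDerivAt.const_mul L).const_add a
  have hg := norm_le_gronwallBound_of_norm_deriv_right_le (a := 0) (b := T) (δ := a) (K := L)
    (ε := 0) (f := fun t => a + L * ∫ s in (0 : ℝ)..t, d s) (f' := fun t => L * d t)
    (fun t _ => (hderiv t).continuousAt.continuousWithinAt)
    (fun t _ => (hderiv t).hasDerivWithinAt) (by simp [abs_of_nonneg ha0]) (fun t ht => by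
      have h1 := hmain t ht.1 ht.2.le
      have h2 : 0 ≤ d t := norm_nonneg _
      rw [Real.norm_eq_abs, Real.norm_eq_abs, abs_of_nonneg (by positivity),
        abs_of_nonneg (h2.trans h1), add_zero]
      gcongr) t ⟨ht, htT⟩
  rw [gronwallBound_ε0, sub_zero] at hg
  have := (hmain t ht htT).trans ((le_abs_self _).trans hg)
  simpa [hd, max_eq_left ht] using this

theorem IsMild.norm_sub_le_of_lipschitz (hE : IsHeat lam e E) (hpos : ∀ n, 0 < lam n)
    (hL : 0 ≤ L) (hF : ∀ u v : H, ‖F u - F v‖ ≤ L * ‖u - v‖) (hu : IsMild E F u₀ u)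
    (hv : IsMild E F v₀ v) {t : ℝ} (ht : 0 ≤ t) :
    ‖u t - v t‖ ≤ Real.exp (L * t) * ‖u₀ - v₀‖ := by
  have hFc := continuous_of_norm_sub_le hF
  have := hu.norm_sub_le hE hpos hL hFc hFc hv (ε := 0) (T := t) le_rfl
    (fun s _ _ => by simpa using hF _ _) ht le_rfl
  simpa [mul_comm] using this

theorem exists_isSolutionSemigroup (hK : IsSpectral A lam e K) (hE : IsHeat lam e E)
    (hL : 0 < L) (hF : ∀ u v : H, ‖F u - F v‖ ≤ L * ‖u - v‖) :
    ∃ S : ℝ → H → H, IsSolutionSemigroup A F S := by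
  have hFc := continuous_of_norm_sub_le hF
  choose U hU using hE.exists_isMild hK.pos hL hF
  refine ⟨fun t x => U x t, fun x => (hU x).isSolution hK hE hFc, fun x u hu t ht => ?_⟩
  have := (hu.isMild hK hE hFc).norm_sub_le_of_lipschitz hE hK.pos hL.le hF (hU x) ht
  rw [sub_self, norm_zero, mul_zero, norm_le_zero_iff, sub_eq_zero] at this
  exact this

end Mild

/-! ### The global attractor -/

/-- A semigroup with a forward invariant absorbing set that it maps to totally bounded sets has a
global attractor. -/
theorem exists_isGlobalAttractor {S : ℝ → H → H} {B₀ : Set H}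
    (hadd : ∀ s t : ℝ, 0 ≤ s → 0 ≤ t → ∀ x, S (s + t) x = S s (S t x))
    (hcont : ∀ t, 0 ≤ t → Continuous (S t))
    (hinv : ∀ t, 0 ≤ t → S t '' B₀ ⊆ B₀)
    (htb : ∀ t, 1 ≤ t → TotallyBounded (S t '' B₀))
    (habs : ∀ B : Set H, Bornology.IsBounded B → ∃ T : ℝ, 0 ≤ T ∧ ∀ t, T ≤ t → S t '' B ⊆ B₀) :
    ∃ 𝒜 : Set H, IsGlobalAttractor S 𝒜 := by
  -- The attractor is the intersection of this decreasing sequence of compact sets.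
  set V : ℕ → Set H := fun n => closure (S (n + 1) '' B₀)
  have hn0 : ∀ n : ℕ, (0 : ℝ) ≤ n + 1 := fun n => by positivity
  have hcpt : ∀ n, IsCompact (V n) := fun n =>
    isCompact_iff_totallyBounded_isComplete.2
      ⟨(htb _ (by simp)).closure, isClosed_closure.isComplete⟩
  have hmono : ∀ s t : ℝ, 0 ≤ s → s ≤ t → S t '' B₀ ⊆ S s '' B₀ := by
    rintro s t hs hst _ ⟨x, hx, rfl⟩
    refine ⟨S (t - s) x, hinv _ (sub_nonneg.2 hst) ⟨x, hx, rfl⟩, ?_⟩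
    rw [← hadd _ _ hs (sub_nonneg.2 hst), add_sub_cancel]
  have hanti : Antitone V := fun m n hmn =>
    closure_mono (hmono _ _ (hn0 m) (by gcongr))
  have hdir : Directed (fun x1 x2 => x1 ⊇ x2) V := hanti.directed_ge
  have hsub : ∀ t, 0 ≤ t → ∀ n, S t '' V n ⊆ V n := by
    intro t ht n
    refine (image_closure_subset_closure_image (hcont t ht)).trans (closure_mono ?_)
    rw [image_image]
    rintro _ ⟨x, hx, rfl⟩
    beta_reduce
    rw [← hadd _ _ ht (hn0 n), add_comm t, hadd _ _ (hn0 n) ht]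
    exact ⟨_, hinv t ht ⟨x, hx, rfl⟩, rfl⟩
  refine ⟨⋂ n, V n, (hcpt 0).of_isClosed_subset
    (isClosed_iInter fun n => isClosed_closure) (iInter_subset _ 0),
    fun t ht => Subset.antisymm ?_ ?_, ?_⟩
  · rintro _ ⟨x, hx, rfl⟩
    exact mem_iInter.2 fun n => hsub t ht n ⟨x, mem_iInter.1 hx n, rfl⟩
  · intro y hy
    obtain ⟨m, hm⟩ := exists_nat_ge t
    have hclosed : IsClosed (S t ⁻¹' {y}) := isClosed_singleton.preimage (hcont t ht)
    -- Backward invariance: `y` has a preimage in every `V n`, and nested nonempty compact sets of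
    -- preimages share a point.
    obtain ⟨x, hx⟩ := IsCompact.nonempty_iInter_of_directed_nonempty_isCompact_isClosed
      (fun n => V n ∩ S t ⁻¹' {y})
      (Antitone.directed_ge fun m n hmn => inter_subset_inter_left _ (hanti hmn)) (fun n => by
        have h1 : y ∈ closure (S t '' (S (n + 1) '' B₀)) := by
          refine closure_mono ?_ (mem_iInter.1 hy (n + m))
          refine (hmono (t + (n + 1)) _ (by positivity) (by push_cast; linarith)).trans ?_
          rintro _ ⟨x, hx, rfl⟩
          exact ⟨_, ⟨x, hx, rfl⟩, (hadd _ _ ht (hn0 n) x).symm⟩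
        have h2 : closure (S t '' (S (n + 1) '' B₀)) ⊆ S t '' V n :=
          closure_minimal (image_mono subset_closure) ((hcpt n).image (hcont t ht)).isClosed
        obtain ⟨x, hx, hxy⟩ := h2 h1
        exact ⟨x, hx, hxy⟩)
      (fun n => (hcpt n).inter_right hclosed) (fun n => isClosed_closure.inter hclosed)
    rw [mem_iInter] at hx
    exact ⟨x, mem_iInter.2 fun n => (hx n).1, (hx 0).2⟩
  · intro B hB ε hε
    obtain ⟨T, hT, h⟩ := habs B hB
    obtain ⟨n, hn⟩ := exists_subset_nhds_of_isCompact' hdir hcpt (fun n => isClosed_closure)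
      (U := Metric.thickening ε (⋂ n, V n)) fun x hx =>
        Metric.isOpen_thickening.mem_nhds (Metric.self_subset_thickening hε _ hx)
    refine ⟨T + (n + 1), by positivity, fun t ht => Subset.trans ?_ hn⟩
    rintro _ ⟨x, hx, rfl⟩
    refine subset_closure ⟨S (t - (n + 1)) x, h _ (by linarith) ⟨x, hx, rfl⟩, ?_⟩
    rw [← hadd _ _ (hn0 n) (by linarith), add_sub_cancel]

/-- This places equilibria, and points with a bounded backward orbit, in the attractor. -/
theorem IsGlobalAttractor.mem_of_forall_mem_image {S : ℝ → H → H} {𝒜 : Set H}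
    (h𝒜 : IsGlobalAttractor S 𝒜) {B : Set H} (hB : Bornology.IsBounded B) {y : H}
    (hy : ∀ t, 0 ≤ t → y ∈ S t '' B) : y ∈ 𝒜 := by
  rw [← h𝒜.isCompact.isClosed.closure_eq, Metric.mem_closure_iff]
  intro ε hε
  obtain ⟨T, hT, h⟩ := h𝒜.attracts B hB ε hε
  obtain ⟨z, hz, hyz⟩ := Metric.mem_thickening_iff.1 (h T le_rfl (hy T hT))
  exact ⟨z, hz, hyz⟩

/-! ### Dissipativity and asymptotic compactness for a bounded nonlinearity. -/

section Semigroup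

variable {A : H →ₗ.[ℝ] H} {lam : ℕ → ℝ} {e : HilbertBasis ℕ ℝ H} {K : H →L[ℝ] H}
  {E : ℝ → H →L[ℝ] H} {F : H → H} {S : ℝ → H → H} {L M : ℝ}

theorem IsSolutionSemigroup.add (hS : IsSolutionSemigroup A F S) {s t : ℝ} (hs : 0 ≤ s)
    (ht : 0 ≤ t) (x : H) : S (s + t) x = S s (S t x) := by
  have h := hS.isSolution x
  refine hS.unique (S t x) (fun r => S (r + t) x) ⟨?_, by simp, fun φ r hr => ?_⟩ s hs
  · exact h.continuousOn.comp (by fun_prop) fun r hr => add_nonneg (mem_Ici.1 hr) ht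
  · exact (h.equation φ (r + t) (by positivity)).comp_add_const r t

theorem IsSolutionSemigroup.isMild (hS : IsSolutionSemigroup A F S) (hK : IsSpectral A lam e K)
    (hE : IsHeat lam e E) (hF : Continuous F) (x : H) : IsMild E F x fun t => S t x :=
  (hS.isSolution x).isMild hK hE hF

theorem IsSolutionSemigroup.norm_sub_le (hS : IsSolutionSemigroup A F S)
    (hK : IsSpectral A lam e K) (hE : IsHeat lam e E) (hL : 0 ≤ L)
    (hF : ∀ u v : H, ‖F u - F v‖ ≤ L * ‖u - v‖) {t : ℝ} (ht : 0 ≤ t) (x y : H) :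
    ‖S t x - S t y‖ ≤ Real.exp (L * t) * ‖x - y‖ :=
  have hFc := continuous_of_norm_sub_le hF
  (hS.isMild hK hE hFc x).norm_sub_le_of_lipschitz hE hK.pos hL hF (hS.isMild hK hE hFc y) ht

theorem IsMild.norm_le {u₀ : H} {u : ℝ → H} (hu : IsMild E F u₀ u) (hK : IsSpectral A lam e K)
    (hE : IsHeat lam e E) (hM : ∀ x, ‖F x‖ ≤ M) {t : ℝ} (ht : 0 ≤ t) :
    ‖u t‖ ≤ Real.exp (-lam 0 * t) * ‖u₀‖ + M / lam 0 * (1 - Real.exp (-lam 0 * t)) := by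
  have hl := hK.pos 0
  have hi := norm_integral_le_exp (f := fun s => E (t - s) (F (u s)))
    (C := M * Real.exp (-lam 0 * t)) (κ := lam 0) hl ht (fun s hs0 hs => by
      refine (hE.norm_le hK.monotone (sub_nonneg.2 hs) _).trans ?_
      rw [mul_assoc, ← Real.exp_add, mul_comm M]
      refine (mul_le_mul_of_nonneg_left (hM _) (Real.exp_pos _).le).trans_eq ?_
      congr 2
      ring)
  rw [hu.formula t ht]
  refine (norm_add_le _ _).trans (add_le_add (hE.norm_le hK.monotone ht _) (hi.trans_eq ?_))
  have : Real.exp (-lam 0 * t) * Real.exp (lam 0 * t) = 1 := by rw [← Real.exp_add]; simp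
  calc _ = M / lam 0 * (Real.exp (-lam 0 * t) * Real.exp (lam 0 * t) -
        Real.exp (-lam 0 * t)) := by ring
    _ = _ := by rw [this]

theorem IsMild.norm_sub_heat_le {u₀ : H} {u : ℝ → H} (hu : IsMild E F u₀ u)
    (hK : IsSpectral A lam e K) (hE : IsHeat lam e E) (hM : ∀ x, ‖F x‖ ≤ M) {t : ℝ} (ht : 0 ≤ t) :
    ‖u t - E t u₀‖ ≤ M * t := by
  rw [hu.formula t ht, add_sub_cancel_left]
  have := intervalIntegral.norm_integral_le_of_norm_le_const (a := 0) (b := t)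
    (f := fun s => E (t - s) (F (u s))) (C := M) fun s _ =>
      (hE.norm_le_self hK.pos _ _).trans (hM _)
  rwa [sub_zero, abs_of_nonneg ht] at this

/-- Over a short time `δ` the flow differs from the compact operator `E δ` by at most `M * δ`,
uniformly in the initial point. Splitting off a last step of length `δ` shows that images of the
absorbing ball are totally bounded, with no smoothing estimate needed. -/
theorem IsSolutionSemigroup.exists_isGlobalAttractor (hS : IsSolutionSemigroup A F S)
    (hK : IsSpectral A lam e K) (hE : IsHeat lam e E) (hL : 0 ≤ L)
    (hF : ∀ u v : H, ‖F u - F v‖ ≤ L * ‖u - v‖) (hM : ∀ x, ‖F x‖ ≤ M) :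
    ∃ 𝒜 : Set H, IsGlobalAttractor S 𝒜 := by
  have hFc := continuous_of_norm_sub_le hF
  have hl := hK.pos 0
  have hM0 : 0 ≤ M := (norm_nonneg _).trans (hM 0)
  -- Solutions are eventually bounded by any radius above `M / lam 0`; the margin `1` makes the ball
  -- absorbing.
  set R := M / lam 0 + 1 with hR
  have hq : 0 ≤ M / lam 0 := by positivity
  have hbound : ∀ x t, 0 ≤ t →
      ‖S t x‖ ≤ Real.exp (-lam 0 * t) * ‖x‖ + M / lam 0 * (1 - Real.exp (-lam 0 * t)) :=
    fun x t ht => (hS.isMild hK hE hFc x).norm_le hK hE hM ht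
  have hexp : ∀ t, 0 ≤ t → Real.exp (-lam 0 * t) ≤ 1 := fun t ht =>
    Real.exp_le_one_iff.2 (by rw [neg_mul, neg_nonpos]; positivity)
  have hinv : ∀ t, 0 ≤ t → S t '' Metric.closedBall 0 R ⊆ Metric.closedBall 0 R := by
    rintro t ht _ ⟨x, hx, rfl⟩
    rw [mem_closedBall_zero_iff] at hx ⊢
    have h1 := hbound x t ht
    have h2 := Real.exp_pos (-lam 0 * t)
    have h3 := hexp t ht
    nlinarith
  refine AbstractParabolic.exists_isGlobalAttractor (B₀ := Metric.closedBall 0 R)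
    (fun s t hs ht x => hS.add hs ht x) (fun t ht => ?_) hinv
    (fun t ht => ?_) fun B hB => ?_
  · exact continuous_of_norm_sub_le (hS.norm_sub_le hK hE hL hF ht)
  · rw [Metric.totallyBounded_iff]
    intro ε hε
    obtain ⟨δ, hδ0, hδ1, hδ⟩ : ∃ δ : ℝ, 0 < δ ∧ δ ≤ 1 ∧ M * δ < ε / 2 := by
      refine ⟨min 1 (ε / (2 * (M + 1)) / 2), lt_min one_pos (by positivity), min_le_left _ _, ?_⟩
      have h1 : M * min 1 (ε / (2 * (M + 1)) / 2) ≤ (M + 1) * (ε / (2 * (M + 1)) / 2) :=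
        mul_le_mul (by linarith) (min_le_right _ _) (by positivity) (by positivity)
      have h2 : (M + 1) * (ε / (2 * (M + 1)) / 2) = ε / 4 := by field_simp; norm_num
      linarith
    have htb : TotallyBounded (E δ '' Metric.closedBall 0 R) := by
      obtain ⟨C, hC, hEC⟩ := (hK.isCompactOperator_heat hE hδ0).image_closedBall_subset_compact
        (f := (E δ : H →ₗ[ℝ] H)) R
      exact hC.totallyBounded.subset hEC
    obtain ⟨s, hs, hcov⟩ := Metric.totallyBounded_iff.1 htb (ε / 2) (by positivity)
    refine ⟨s, hs, ?_⟩
    rintro _ ⟨x, hx, rfl⟩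
    set z := S (t - δ) x
    have hz : z ∈ Metric.closedBall 0 R := hinv _ (by linarith) ⟨x, hx, rfl⟩
    have h1 : ‖S δ z - E δ z‖ ≤ M * δ :=
      (hS.isMild hK hE hFc z).norm_sub_heat_le hK hE hM hδ0.le
    have h2 : S t x = S δ z := by
      rw [← hS.add hδ0.le (by linarith), add_sub_cancel]
    obtain ⟨y, hy, hyz⟩ := mem_iUnion₂.1 (hcov ⟨z, hz, rfl⟩)
    refine mem_iUnion₂.2 ⟨y, hy, ?_⟩
    rw [Metric.mem_ball] at hyz ⊢
    rw [h2]
    calc dist (S δ z) y ≤ dist (S δ z) (E δ z) + dist (E δ z) y := dist_triangle _ _ _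
      _ < ε := by rw [dist_eq_norm (S δ z)]; linarith
  · obtain ⟨r, hr⟩ := hB.exists_norm_le
    have hlim : Tendsto (fun t => Real.exp (-lam 0 * t) * |r|) atTop (𝓝 0) := by
      have : Tendsto (fun t => -lam 0 * t) atTop atBot :=
        tendsto_id.const_mul_atTop_of_neg (by linarith)
      simpa using (Real.tendsto_exp_atBot.comp this).mul_const |r|
    obtain ⟨T, hT⟩ := eventually_atTop.1 (hlim.eventually (gt_mem_nhds one_pos))
    refine ⟨max T 0, le_max_right _ _, fun t ht => ?_⟩
    rintro _ ⟨x, hx, rfl⟩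
    have ht0 : 0 ≤ t := (le_max_right _ _).trans ht
    have h1 := hbound x t ht0
    have h2 := hT t ((le_max_left _ _).trans ht)
    have h3 := Real.exp_pos (-lam 0 * t)
    have h4 : Real.exp (-lam 0 * t) * ‖x‖ ≤ Real.exp (-lam 0 * t) * |r| := by
      gcongr; exact (hr x hx).trans (le_abs_self r)
    rw [mem_closedBall_zero_iff]
    nlinarith [hexp t ht0]

end Semigroup

/-! ### Linearization at an equilibrium -/

section Linearization

variable {A : H →ₗ.[ℝ] H} {lam : ℕ → ℝ} {e : HilbertBasis ℕ ℝ H} {K : H →L[ℝ] H}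
  {E : ℝ → H →L[ℝ] H} {F : H → H} {S : ℝ → H → H} {L : ℝ} {p : H}

theorem exists_linearFlow (hK : IsSpectral A lam e K) (hE : IsHeat lam e E) (T : H →L[ℝ] H) :
    ∃ G : ℝ → H →L[ℝ] H, IsSolutionSemigroup A T fun t x => G t x := by
  have hT : ∀ u v : H, ‖T u - T v‖ ≤ (‖T‖ + 1) * ‖u - v‖ := fun u v => by
    rw [← map_sub]
    exact (T.le_opNorm _).trans (by gcongr; linarith)
  have hL : 0 < ‖T‖ + 1 := by positivity
  obtain ⟨S, hS⟩ := exists_isSolutionSemigroup hK hE hL hT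
  have hlin : ∀ t : ℝ, 0 ≤ t → ∃ G : H →L[ℝ] H, ∀ x, G x = S t x := by
    intro t ht
    let G₀ : H →ₗ[ℝ] H :=
      { toFun := S t
        map_add' := fun x y => by
          have hx := hS.isSolution x
          have hy := hS.isSolution y
          refine (hS.unique (x + y) (fun t => S t x + S t y)
            ⟨hx.continuousOn.add hy.continuousOn, by rw [hx.initial, hy.initial],
            fun φ t ht => ?_⟩ t ht).symm
          simp only [inner_add_left, map_add]
          exact ((hx.equation φ t ht).add (hy.equation φ t ht)).congr_deriv (by ring)
        map_smul' := fun a x => by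
          have hx := hS.isSolution x
          refine (hS.unique (a • x) (fun t => a • S t x)
            ⟨hx.continuousOn.const_smul a, by rw [hx.initial], fun φ t ht => ?_⟩ t ht).symm
          simp only [inner_smul_left, map_smul, RCLike.conj_to_real]
          exact ((hx.equation φ t ht).const_mul a).congr_deriv (by ring) }
    refine ⟨⟨G₀, continuous_of_norm_sub_le (hS.norm_sub_le hK hE hL.le hT ht)⟩, fun x => rfl⟩
  choose G hG using fun t : ℝ => hlin (max t 0) (le_max_right _ _)
  refine ⟨G, fun x => ?_, fun x u hu t ht => ?_⟩
  · simpa only [hG] using (hS.isSolution x).comp_max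
  · rw [hG, max_eq_left ht]
    exact hS.unique x u hu t ht

theorem IsSolutionSemigroup.eq_self_of_equilibrium (hS : IsSolutionSemigroup A F S)
    (hp : ∀ φ : A.domain, ⟪F p, (φ : H)⟫ = ⟪p, A φ⟫) {t : ℝ} (ht : 0 ≤ t) : S t p = p := by
  refine (hS.unique p (fun _ => p) ⟨continuousOn_const, rfl, fun φ t _ => ?_⟩ t ht).symm
  rw [hp, sub_self]
  exact hasDerivAt_const _ _

/-- The displacement `S s x - p` solves the linearized equation up to the Taylor remainder of `F` at
`p`. Up to time `t` the displacement is `O(‖x - p‖)`, so the remainder is `o(‖x - p‖)`, and Gronwall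
transfers this to the solutions. -/
theorem IsSolutionSemigroup.hasFDerivAt (hS : IsSolutionSemigroup A F S)
    (hK : IsSpectral A lam e K) (hE : IsHeat lam e E) (hL : 0 ≤ L)
    (hF : ∀ u v : H, ‖F u - F v‖ ≤ L * ‖u - v‖)
    (hp : ∀ φ : A.domain, ⟪F p, (φ : H)⟫ = ⟪p, A φ⟫) {T : H →L[ℝ] H} (hT : HasFDerivAt F T p)
    {G : ℝ → H →L[ℝ] H} (hG : IsSolutionSemigroup A T fun t x => G t x) {t : ℝ} (ht : 0 ≤ t) :
    HasFDerivAt (S t) (G t) p := by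
  have hFc := continuous_of_norm_sub_le hF
  have hSp : ∀ t, 0 ≤ t → S t p = p := fun t ht => hS.eq_self_of_equilibrium hp ht
  have hsol : ∀ x, IsSolution A (fun w => F (p + w) - F p) (x - p) fun t => S t x - p := by
    intro x
    have hx := hS.isSolution x
    refine ⟨hx.continuousOn.sub continuousOn_const, by rw [hx.initial], fun φ t ht => ?_⟩
    simp only [inner_sub_left, add_sub_cancel]
    exact ((hx.equation φ t ht).sub_const _).congr_deriv (by rw [hp]; ring)
  have hFc' : Continuous fun w => F (p + w) - F p := by fun_prop
  rw [hasFDerivAt_iff_isLittleO, Asymptotics.isLittleO_iff]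
  intro c hc
  rw [hSp t ht]
  -- The factor `t + 1` in place of `t` keeps `N` positive at `t = 0`.
  set N := Real.exp (L * t) * (t + 1) * Real.exp (‖T‖ * t) with hN
  have hN0 : 0 < N := by positivity
  have hcN : 0 < c / N := by positivity
  obtain ⟨ρ, hρ, hball⟩ := Metric.eventually_nhds_iff.1
    (Asymptotics.isLittleO_iff.1 (hasFDerivAt_iff_isLittleO.1 hT) hcN)
  have hρ' : 0 < ρ / Real.exp (L * t) := by positivity
  filter_upwards [Metric.ball_mem_nhds p hρ'] with x hx
  rw [Metric.mem_ball, dist_eq_norm, lt_div_iff₀ (Real.exp_pos _)] at hx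
  have hw : ∀ s, 0 ≤ s → s ≤ t → ‖S s x - p‖ ≤ Real.exp (L * t) * ‖x - p‖ := by
    intro s hs hst
    have := hS.norm_sub_le hK hE hL hF hs x p
    rw [hSp s hs] at this
    exact this.trans (by gcongr)
  have := ((hsol x).isMild hK hE hFc').norm_sub_le hE hK.pos (norm_nonneg T) hFc' T.continuous
    (hG.isMild hK hE T.continuous (x - p)) (ε := c / N * (Real.exp (L * t) * ‖x - p‖)) (T := t)
    (by positivity) (fun s hs hst => by
      have h1 := hball (y := S s x) (by
        rw [dist_eq_norm]
        exact (hw s hs hst).trans_lt (by linarith))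
      have h2 := T.le_opNorm (S s x - p - G s (x - p))
      rw [map_sub] at h2
      have h3 : c / N * ‖S s x - p‖ ≤ c / N * (Real.exp (L * t) * ‖x - p‖) := by
        gcongr; exact hw s hs hst
      calc ‖F (p + (S s x - p)) - F p - T (G s (x - p))‖
          = ‖(F (S s x) - F p - T (S s x - p)) + (T (S s x - p) - T (G s (x - p)))‖ := by
            rw [add_sub_cancel]; congr 1; abel
        _ ≤ _ := (norm_add_le _ _).trans (by linarith)) ht le_rfl
  refine this.trans ?_
  rw [sub_self, norm_zero, zero_add]
  have h4 : c / N * (Real.exp (L * t) * ‖x - p‖) * t * Real.exp (‖T‖ * t) ≤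
      c / N * (Real.exp (L * t) * ‖x - p‖) * (t + 1) * Real.exp (‖T‖ * t) := by
    gcongr; linarith
  refine h4.trans_eq ?_
  calc _ = c / N * N * ‖x - p‖ := by rw [hN]; ring
    _ = _ := by rw [div_mul_cancel₀ _ hN0.ne']

end Linearization

/-! ### Tangent vectors of a submanifold -/

/-- One-sided tangent vectors of `M` at `p`. -/
def IsTangentVector (M : Set H) (p v : H) : Prop :=
  ∃ γ : ℝ → H, γ 0 = p ∧ (∀ᶠ s in 𝓝[>] (0 : ℝ), γ s ∈ M) ∧ HasDerivWithinAt γ v (Ioi 0) 0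

/-- Describing tangent vectors by curves in `M` makes their invariance immediate: no chart has to be
carried along by the flow. -/
theorem IsTangentVector.image {M : Set H} {p v : H} (h : IsTangentVector M p v) {f : H → H}
    {f' : H →L[ℝ] H} (hf : HasFDerivAt f f' p) (hp : f p = p) (hM : f '' M ⊆ M) :
    IsTangentVector M p (f' v) := by
  obtain ⟨γ, h0, hγ, hd⟩ := h
  refine ⟨f ∘ γ, by simp [h0, hp], hγ.mono fun s hs => hM ⟨_, hs, rfl⟩, ?_⟩
  rw [← h0] at hf
  exact hf.comp_hasDerivWithinAt 0 hd

/-- The embedding property makes the parameters `ξ k` converge to `x₀`. Injectivity of `D` makes `ξ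
k - x₀` comparable to `y k - ψ x₀`, so rescaled secants are asymptotically in the range of `D`,
which is closed by finite dimension. -/
theorem mem_range_of_tendsto_of_isEmbedding {X : Type*} [NormedAddCommGroup X] [NormedSpace ℝ X]
    [FiniteDimensional ℝ X] {O : Set X} {ψ : X → H} {D : X →L[ℝ] H} {x₀ : X} (hx₀ : x₀ ∈ O)
    (hD : HasFDerivAt ψ D x₀) (hinj : Function.Injective D) (hψ : IsEmbedding (O.domRestrict ψ))
    {ι : Type*} {l : Filter ι} [l.NeBot] {y : ι → H} {c : ι → ℝ} {w : H}
    (hy : ∀ᶠ k in l, y k ∈ ψ '' O) (hlim : Tendsto y l (𝓝 (ψ x₀)))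
    (hw : Tendsto (fun k => c k • (y k - ψ x₀)) l (𝓝 w)) : w ∈ D.range := by
  have hex : ∀ k, ∃ z : O, y k ∈ ψ '' O → ψ z = y k := fun k => by
    by_cases h : y k ∈ ψ '' O
    · obtain ⟨z, hz, hzy⟩ := h
      exact ⟨⟨z, hz⟩, fun _ => hzy⟩
    · exact ⟨⟨x₀, hx₀⟩, fun h' => absurd h' h⟩
  choose ξ hξ using hex
  have hyξ : ∀ᶠ k in l, ψ (ξ k) = y k := hy.mono fun k hk => hξ k hk
  have hξlim : Tendsto (fun k => (ξ k : X)) l (𝓝 x₀) := by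
    have : Tendsto ξ l (𝓝 (⟨x₀, hx₀⟩ : O)) := by
      rw [hψ.tendsto_nhds_iff]
      exact hlim.congr' (hyξ.mono fun k hk => hk.symm)
    exact (continuous_subtype_val.tendsto _).comp this
  set f₁ : ι → H := fun k => y k - ψ x₀ - D (ξ k - x₀) with hf₁
  have h1 : f₁ =o[l] fun k => (ξ k : X) - x₀ := by
    refine ((hasFDerivAt_iff_isLittleO.1 hD).comp_tendsto hξlim).congr' ?_ EventuallyEq.rfl
    filter_upwards [hyξ] with k hk
    simp [hf₁, hk]
  obtain ⟨C, -, hC⟩ := (LinearMap.injective_iff_antilipschitz (D : X →ₗ[ℝ] H)).1 hinj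
  have h2 : (fun k => (ξ k : X) - x₀) =O[l] fun k => D (ξ k - x₀) := by
    refine Asymptotics.IsBigO.of_bound C (Eventually.of_forall fun k => ?_)
    simpa using hC.le_mul_dist (ξ k - x₀ : X) 0
  have h3 := (h1.trans_isBigO h2).right_isBigO_add
  have h4 : f₁ =o[l] fun k => y k - ψ x₀ :=
    ((h1.trans_isBigO h2).trans_isBigO h3).congr_right fun k => by simp [hf₁]
  have h5 : Tendsto (fun k => c k • f₁ k) l (𝓝 0) := by
    refine (Asymptotics.isLittleO_one_iff ℝ).1 ?_
    exact ((Asymptotics.isBigO_refl c l).smul_isLittleO h4).trans_isBigO (hw.isBigO_one ℝ)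
  have h6 : Tendsto (fun k => D (c k • (ξ k - x₀))) l (𝓝 w) := by
    have := hw.sub h5
    rw [sub_zero] at this
    refine this.congr fun k => ?_
    rw [← smul_sub, hf₁, sub_sub_cancel, map_smul]
  have hcl : IsClosed (D.range : Set H) := Submodule.closed_of_finiteDimensional _
  exact hcl.mem_of_tendsto h6 (Eventually.of_forall fun k => ⟨_, rfl⟩)

theorem IsC1Submanifold.exists_tangentSpace {n : ℕ} {M : Set H} (hM : IsC1Submanifold n M) {p : H}
    (hp : p ∈ M) : ∃ V : Submodule ℝ H, FiniteDimensional ℝ V ∧ Module.finrank ℝ V = n ∧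
      ∀ v, v ∈ V ↔ IsTangentVector M p v := by
  obtain ⟨U, O, ψ, hU, hpU, hO, hψ, hinj, hemb, himg⟩ := hM p hp
  obtain ⟨x₀, hx₀, rfl⟩ : p ∈ ψ '' O := himg ▸ ⟨hp, hpU⟩
  have hD : HasFDerivAt ψ (fderiv ℝ ψ x₀) x₀ :=
    ((hψ.differentiableOn one_ne_zero).differentiableAt (hO.mem_nhds hx₀)).hasFDerivAt
  refine ⟨(fderiv ℝ ψ x₀).range, inferInstance, ?_, fun v => ⟨?_, ?_⟩⟩
  · rw [LinearMap.finrank_range_of_inj (hinj x₀ hx₀)]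
    simp
  · rintro ⟨ξ, rfl⟩
    have hline : HasDerivAt (fun s : ℝ => x₀ + s • ξ) ξ 0 := by
      simpa using ((hasDerivAt_id (0 : ℝ)).smul_const ξ).const_add x₀
    refine ⟨fun s => ψ (x₀ + s • ξ), by simp, ?_, ?_⟩
    · have h0 : Tendsto (fun s : ℝ => x₀ + s • ξ) (𝓝[>] 0) (𝓝 x₀) := by
        have := hline.continuousAt.tendsto
        simp only [zero_smul, add_zero] at this
        exact this.mono_left nhdsWithin_le_nhds
      filter_upwards [h0 (hO.mem_nhds hx₀)] with s hs
      exact (himg.subset ⟨_, hs, rfl⟩).1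
    · refine HasDerivAt.hasDerivWithinAt ?_
      refine HasFDerivAt.comp_hasDerivAt (f := fun s : ℝ => x₀ + s • ξ) 0 ?_ hline
      simpa using hD
  · rintro ⟨γ, h0, hγ, hd⟩
    have hc : Tendsto γ (𝓝[>] 0) (𝓝 (ψ x₀)) := h0 ▸ hd.continuousWithinAt
    refine mem_range_of_tendsto_of_isEmbedding hx₀ hD (hinj x₀ hx₀) hemb (l := 𝓝[>] (0 : ℝ))
      (y := γ) (c := fun s => s⁻¹) ?_ hc ?_
    · filter_upwards [hγ, hc (hU.mem_nhds hpU)] with s hs hsU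
      exact himg ▸ ⟨hs, hsU⟩
    · have := (hasDerivWithinAt_iff_tendsto_slope' (by simp)).1 hd
      simpa [slope_fun_def, h0] using this

/-! ### Parity of the dimension -/

theorem exists_isRoot_of_odd_natDegree {P : Polynomial ℝ} (hP : P.Monic) (hodd : Odd P.natDegree) :
    ∃ x, P.IsRoot x := by
  have hdeg : 0 < P.natDegree := hodd.pos
  have h1 : Tendsto (fun x => P.eval x) atTop atTop :=
    P.tendsto_atTop_of_leadingCoeff_nonneg (Polynomial.natDegree_pos_iff_degree_pos.1 hdeg)
      (by rw [hP.leadingCoeff]; exact zero_le_one)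
  have hnd : (P.comp (-Polynomial.X)).natDegree = P.natDegree := by
    rw [Polynomial.natDegree_comp]; simp
  have h2 : Tendsto (fun x => (P.comp (-Polynomial.X)).eval x) atTop atBot := by
    refine Polynomial.tendsto_atBot_of_leadingCoeff_nonpos _
      (Polynomial.natDegree_pos_iff_degree_pos.1 (by rwa [hnd])) ?_
    rw [Polynomial.leadingCoeff_comp (by simp), hP.leadingCoeff]
    simp [hodd.neg_one_pow]
  obtain ⟨a, ha⟩ := (h1.eventually_ge_atTop 0).exists
  obtain ⟨b, hb⟩ := (h2.eventually_le_atBot 0).exists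
  rw [Polynomial.eval_comp] at hb
  exact mem_range_of_exists_le_of_exists_ge P.continuous ⟨_, hb⟩ ⟨_, ha⟩

/-- In odd dimension the characteristic polynomial would have a real root, hence an eigenvector in
`V`. -/
theorem even_finrank_of_forall_ne {V : Submodule ℝ H} [FiniteDimensional ℝ V] {G : H →L[ℝ] H}
    (hV : ∀ v ∈ V, G v ∈ V) (hG : ∀ μ : ℝ, ∀ v ∈ V, G v = μ • v → v = 0) :
    Even (Module.finrank ℝ V) := by
  by_contra hodd
  rw [Nat.not_even_iff_odd] at hodd
  let f : Module.End ℝ V := (G : H →ₗ[ℝ] H).restrict hV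
  obtain ⟨μ, hμ⟩ := exists_isRoot_of_odd_natDegree f.charpoly_monic
    (by rwa [LinearMap.charpoly_natDegree])
  obtain ⟨v, hv⟩ := ((Module.End.hasEigenvalue_iff_isRoot_charpoly f μ).2 hμ).exists_hasEigenvector
  refine hv.2 (Subtype.ext (hG μ v v.2 ?_))
  simpa [f] using congrArg (Subtype.val) hv.apply_eq_smul

/-! ### Rotating pairs of modes -/

/-- With `α`, `δ` the mean and half-difference of the decay rates, the system is `z' = (-α + N) z`,
where `N = [[δ, -b], [b, -δ]]` satisfies `N² = -w²`. Thus the flow is `exp (-αt) (cos (wt) + sin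
(wt) N / w)`, which has no real eigenvalue while `0 < wt < π`. -/
theorem eq_zero_of_rotation {x y : ℝ → ℝ} {a b c μ : ℝ} (hab : |a - c| / 2 < b)
    (hxc : ContinuousOn x (Ici 0)) (hyc : ContinuousOn y (Ici 0))
    (hx : ∀ t, 0 < t → HasDerivAt x (-b * y t - a * x t) t)
    (hy : ∀ t, 0 < t → HasDerivAt y (b * x t - c * y t) t)
    (hxμ : x (1 / b) = μ * x 0) (hyμ : y (1 / b) = μ * y 0) : x 0 = 0 ∧ y 0 = 0 := by
  have hb : 0 < b := lt_of_le_of_lt (by positivity) hab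
  obtain ⟨α, hα⟩ : ∃ α, α = (a + c) / 2 := ⟨_, rfl⟩
  obtain ⟨δ, hδ⟩ : ∃ δ, δ = (c - a) / 2 := ⟨_, rfl⟩
  have ha : a = α - δ := by rw [hα, hδ]; ring
  have hc : c = α + δ := by rw [hα, hδ]; ring
  have hδb : δ ^ 2 < b ^ 2 := by
    rw [sq_lt_sq, abs_of_pos hb, hδ, abs_div, abs_sub_comm, abs_of_pos (zero_lt_two' ℝ)]
    exact hab
  obtain ⟨w, hw⟩ : ∃ w, w = √(b ^ 2 - δ ^ 2) := ⟨_, rfl⟩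
  have hw0 : 0 < w := hw ▸ Real.sqrt_pos.2 (by linarith)
  have hw2 : w ^ 2 = b ^ 2 - δ ^ 2 := hw ▸ Real.sq_sqrt (by linarith)
  have hwb : w ≤ b := by nlinarith
  have ht : (0 : ℝ) ≤ 1 / b := by positivity
  have hsub : Icc 0 (1 / b) ⊆ Ici 0 := fun t ht => ht.1
  have hcos : ∀ t, HasDerivAt (fun t => Real.cos (w * t)) (-Real.sin (w * t) * w) t := fun t => by
    simpa using ((hasDerivAt_id t).const_mul w).cos
  have hsin : ∀ t, HasDerivAt (fun t => Real.sin (w * t)) (Real.cos (w * t) * w) t := fun t => by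
    simpa using ((hasDerivAt_id t).const_mul w).sin
  have hexp : ∀ t, HasDerivAt (fun t => Real.exp (α * t)) (Real.exp (α * t) * α) t := fun t => by
    simpa using ((hasDerivAt_id t).const_mul α).exp
  have hconst : ∀ f : ℝ → ℝ, ContinuousOn f (Icc 0 (1 / b)) →
      (∀ t ∈ Ioo 0 (1 / b), HasDerivAt f 0 t) → f (1 / b) = f 0 := fun f hf hf' => by
    have := intervalIntegral.integral_eq_sub_of_hasDerivAt_of_le ht hf hf' (by simp)
    rw [intervalIntegral.integral_zero] at this
    linarith
  -- `h1` and `h2` express that the two components of `w exp (αt) exp (-tN) z(t)` are conserved.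
  have h1 := hconst (fun t => Real.exp (α * t) *
      (w * (Real.cos (w * t) * x t) - Real.sin (w * t) * (δ * x t - b * y t)))
    (by
      have h1 := hxc.mono hsub
      have h2 := hyc.mono hsub
      fun_prop) fun t ht => by
    have h := (hexp t).mul ((((hcos t).mul (hx t ht.1)).const_mul w).sub
      ((hsin t).mul (((hx t ht.1).const_mul δ).sub ((hy t ht.1).const_mul b))))
    refine h.congr_deriv ?_
    simp only [Pi.mul_apply, Pi.sub_apply, ha, hc]
    linear_combination (-Real.exp (α * t) * Real.sin (w * t) * x t) * hw2
  have h2 := hconst (fun t => Real.exp (α * t) *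
      (w * (Real.cos (w * t) * y t) - Real.sin (w * t) * (b * x t - δ * y t)))
    (by
      have h1 := hxc.mono hsub
      have h2 := hyc.mono hsub
      fun_prop) fun t ht => by
    have h := (hexp t).mul ((((hcos t).mul (hy t ht.1)).const_mul w).sub
      ((hsin t).mul (((hx t ht.1).const_mul b).sub ((hy t ht.1).const_mul δ))))
    refine h.congr_deriv ?_
    simp only [Pi.mul_apply, Pi.sub_apply, ha, hc]
    linear_combination (-Real.exp (α * t) * Real.sin (w * t) * y t) * hw2
  -- The time `1 / b` serves all blocks at once: `w ≤ b` gives `w / b ≤ 1 < π`, whatever the gap.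
  have hsinpos : 0 < Real.sin (w * (1 / b)) := by
    refine Real.sin_pos_of_pos_of_lt_pi (by positivity) (lt_of_le_of_lt ?_ Real.pi_gt_three)
    rw [mul_one_div, div_le_iff₀ hb]
    linarith
  simp only [hxμ, hyμ, mul_zero, Real.exp_zero, Real.cos_zero, Real.sin_zero, one_mul, zero_mul,
    sub_zero] at h1 h2
  obtain ⟨p, hp⟩ : ∃ p, p = Real.exp (α * (1 / b)) * μ * w * Real.cos (w * (1 / b)) - w :=
    ⟨_, rfl⟩
  obtain ⟨q, hq⟩ : ∃ q, q = Real.exp (α * (1 / b)) * μ * Real.sin (w * (1 / b)) := ⟨_, rfl⟩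
  have e1 : (p - q * δ) * x 0 = -(q * b) * y 0 := by rw [hp, hq]; linear_combination h1
  have e2 : (p + q * δ) * y 0 = q * b * x 0 := by rw [hp, hq]; linear_combination h2
  -- `e1` and `e2` say `(p - qN) z(0) = 0`, and this quantity is the determinant of `p - qN`. The
  -- value `μ = 0` is treated apart because then `q = 0`.
  have hpos : 0 < p ^ 2 + q ^ 2 * w ^ 2 := by
    by_cases hμ : μ = 0
    · have : p = -w := by rw [hp, hμ]; ring
      rw [this, neg_sq]
      positivity
    · have : q ≠ 0 := by
        rw [hq]
        exact mul_ne_zero (mul_ne_zero (Real.exp_pos _).ne' hμ) hsinpos.ne'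
      positivity
  constructor
  · refine (mul_eq_zero.1 ?_).resolve_left hpos.ne'
    linear_combination (p + q * δ) * e1 - q * b * e2 + q ^ 2 * x 0 * hw2
  · refine (mul_eq_zero.1 ?_).resolve_left hpos.ne'
    linear_combination (p - q * δ) * e2 + q * b * e1 + q ^ 2 * y 0 * hw2

/-! ### Action of the linearized flow on blocks of modes. -/

section Blocks

variable {A : H →ₗ.[ℝ] H} {lam : ℕ → ℝ} {e : HilbertBasis ℕ ℝ H} {K : H →L[ℝ] H}
  {T : H →L[ℝ] H} {G : ℝ → H →L[ℝ] H}

theorem inner_eq_zero_of_eigenvector (hK : IsSpectral A lam e K)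
    (hG : IsSolutionSemigroup A T fun t x => G t x) {b : ℝ} {i j : ℕ}
    (hb : |lam i - lam j| / 2 < b) (hi : ∀ x, ⟪e i, T x⟫ = -b * ⟪e j, x⟫)
    (hj : ∀ x, ⟪e j, T x⟫ = b * ⟪e i, x⟫) {μ : ℝ} {v : H} (hv : G (1 / b) v = μ • v) :
    ⟪e i, v⟫ = 0 ∧ ⟪e j, v⟫ = 0 := by
  have hs := hG.isSolution v
  have h0 : G 0 v = v := hs.initial
  have hc : ∀ n, ContinuousOn (fun t => ⟪e n, G t v⟫) (Ici 0) := fun n =>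
    continuousOn_const.inner hs.continuousOn
  have := eq_zero_of_rotation (x := fun t => ⟪e i, G t v⟫) (y := fun t => ⟪e j, G t v⟫)
    (a := lam i) (c := lam j) (μ := μ) hb (hc i) (hc j)
    (fun t ht => by simpa only [hi] using hs.hasDerivAt_inner_basis hK i ht)
    (fun t ht => by simpa only [hj] using hs.hasDerivAt_inner_basis hK j ht)
    (by simp only [hv, h0, inner_smul_right]) (by simp only [hv, h0, inner_smul_right])
  simpa only [h0] using this

theorem inner_flow_eq_zero (hK : IsSpectral A lam e K)
    (hG : IsSolutionSemigroup A T fun t x => G t x) {b : ℝ} {i : ℕ}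
    (hi : ∀ x, ⟪e i, T x⟫ = b * ⟪e i, x⟫) {v : H} (hv : ⟪e i, v⟫ = 0) {t : ℝ} (ht : 0 ≤ t) :
    ⟪e i, G t v⟫ = 0 := by
  have hs := (hG.isSolution v).comp_max
  have h0 : G 0 v = v := (hG.isSolution v).initial
  have := variation_of_constants (y := fun t => ⟪e i, G (max t 0) v⟫) (f := fun _ => 0)
    (l := lam i - b) (continuous_const.inner (continuous_comp_max (hG.isSolution v).continuousOn))
    continuous_const (fun t ht => (hs.hasDerivAt_inner_basis hK i ht).congr_deriv (by
      rw [hi]; ring)) ht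
  simpa [max_eq_left ht, h0, hv] using this

end Blocks

/-- The involution `2 * k ↔ 2 * k + 1`. -/
theorem exists_perm_even :
    ∃ π : Equiv.Perm ℕ, ∀ k, π (2 * k) = 2 * k + 1 ∧ π (2 * k + 1) = 2 * k := by
  have hinv : Function.Involutive fun n : ℕ => if n % 2 = 0 then n + 1 else n - 1 := by
    intro n
    dsimp only
    split_ifs <;> omega
  refine ⟨hinv.toPerm, fun k => ⟨?_, ?_⟩⟩ <;> rw [Function.Involutive.coe_toPerm] <;>
    split_ifs <;> omega

/-- The involution `2 * k + 1 ↔ 2 * k + 2`, which fixes `0`. -/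
theorem exists_perm_odd :
    ∃ π : Equiv.Perm ℕ, ∀ k, π (2 * k + 1) = 2 * k + 2 ∧ π (2 * k + 2) = 2 * k + 1 := by
  have hinv : Function.Involutive
      fun n : ℕ => if n = 0 then 0 else if n % 2 = 0 then n - 1 else n + 1 := by
    intro n
    grind
  refine ⟨hinv.toPerm, fun k => ⟨?_, ?_⟩⟩ <;> rw [Function.Involutive.coe_toPerm] <;>
    split_ifs <;> omega

theorem exists_rotation_even (e : HilbertBasis ℕ ℝ H) {b : ℝ} (hb : 0 < b) :
    ∃ T : H →L[ℝ] H, (∀ x, ‖T x‖ ≤ b * ‖x‖) ∧ ∀ k x,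
      ⟪e (2 * k), T x⟫ = -b * ⟪e (2 * k + 1), x⟫ ∧ ⟪e (2 * k + 1), T x⟫ = b * ⟪e (2 * k), x⟫ := by
  obtain ⟨π, hπ⟩ := exists_perm_even
  have hc : ∀ n : ℕ, |if n % 2 = 0 then -b else b| ≤ b := fun n => by
    split_ifs <;> simp [abs_of_pos hb]
  obtain ⟨T, hT⟩ := exists_weightedPerm e π (fun n => if n % 2 = 0 then -b else b) hc
  refine ⟨T, fun x => norm_le_of_abs_inner_le e hb.le π fun n => ?_, fun k x => ⟨?_, ?_⟩⟩
  · rw [hT, abs_mul]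
    exact mul_le_mul_of_nonneg_right (hc n) (abs_nonneg _)
  · rw [hT, (hπ k).1, if_pos (by omega)]
  · rw [hT, (hπ k).2, if_neg (by omega)]

theorem exists_rotation_odd (e : HilbertBasis ℕ ℝ H) {b : ℝ} (hb : 0 < b) :
    ∃ T : H →L[ℝ] H, (∀ x, ‖T x‖ ≤ b * ‖x‖) ∧ (∀ x, ⟪e 0, T x⟫ = 0) ∧ T (e 0) = 0 ∧
      ∀ k x, ⟪e (2 * k + 1), T x⟫ = -b * ⟪e (2 * k + 2), x⟫ ∧
        ⟪e (2 * k + 2), T x⟫ = b * ⟪e (2 * k + 1), x⟫ := by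
  obtain ⟨π, hπ⟩ := exists_perm_odd
  have hc : ∀ n : ℕ, |if n = 0 then 0 else if n % 2 = 0 then b else -b| ≤ b := fun n => by
    split_ifs <;> simp [abs_of_pos hb, hb.le]
  obtain ⟨T, hT⟩ := exists_weightedPerm e π
    (fun n => if n = 0 then 0 else if n % 2 = 0 then b else -b) hc
  have h0 : ∀ x, ⟪e 0, T x⟫ = 0 := fun x => by rw [hT]; simp
  have h1 : ∀ k x, ⟪e (2 * k + 1), T x⟫ = -b * ⟪e (2 * k + 2), x⟫ := fun k x => by
    rw [hT, (hπ k).1, if_neg (by omega), if_neg (by omega)]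
  have h2 : ∀ k x, ⟪e (2 * k + 2), T x⟫ = b * ⟪e (2 * k + 1), x⟫ := fun k x => by
    rw [hT, (hπ k).2, if_neg (by omega), if_pos (by omega)]
  refine ⟨T, fun x => norm_le_of_abs_inner_le e hb.le π fun n => ?_, h0,
    ext_basis e fun n => ?_, fun k x => ⟨h1 k x, h2 k x⟩⟩
  · rw [hT, abs_mul]
    exact mul_le_mul_of_nonneg_right (hc n) (abs_nonneg _)
  · rw [inner_zero_right]
    rcases Nat.eq_zero_or_pos n with rfl | hn
    · exact h0 _
    · rcases Nat.even_or_odd' n with ⟨k, rfl | rfl⟩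
      · obtain ⟨k, rfl⟩ : ∃ m, k = m + 1 := ⟨k - 1, by omega⟩
        rw [show 2 * (k + 1) = 2 * k + 2 by ring, h2, e.orthonormal.2 (by omega), mul_zero]
      · rw [h1, e.orthonormal.2 (by omega), mul_zero]

/-! ### The nonlinearity -/

/-- The smooth `1`-Lipschitz map `x ↦ x / √(1 + ‖x‖²)` onto the unit ball. -/
noncomputable def saturation (x : H) : H := (√(1 + ‖x‖ ^ 2))⁻¹ • x

theorem contDiff_saturation : ContDiff ℝ ∞ (saturation : H → H) :=
  OpenPartialHomeomorph.contDiff_univUnitBall (n := ⊤)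

theorem norm_saturation_le (x : H) : ‖saturation x‖ ≤ 1 := by
  have h : 0 < √(1 + ‖x‖ ^ 2) := Real.sqrt_pos.2 (by positivity)
  rw [saturation, norm_smul, norm_inv, Real.norm_eq_abs, abs_of_pos h, inv_mul_le_one₀ h]
  exact Real.le_sqrt_of_sq_le (by linarith)

/-- Radial projection of `(x, 1)` to the unit sphere of `H × ℝ` gives `(P x, P)`, and `saturation`
is its first component. Off the unit ball radial projection is `1`-Lipschitz, which is the
computation below. -/
theorem norm_saturation_sub_le (x y : H) : ‖saturation x - saturation y‖ ≤ ‖x - y‖ := by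
  have hP : ∀ z : H, 0 < (√(1 + ‖z‖ ^ 2))⁻¹ ∧ (√(1 + ‖z‖ ^ 2))⁻¹ ≤ 1 ∧
      (√(1 + ‖z‖ ^ 2))⁻¹ ^ 2 * (1 + ‖z‖ ^ 2) = 1 := fun z => by
    have h1 : 1 ≤ √(1 + ‖z‖ ^ 2) := Real.one_le_sqrt.2 (by nlinarith [norm_nonneg z])
    refine ⟨by positivity, inv_le_one_of_one_le₀ h1, ?_⟩
    rw [inv_pow, Real.sq_sqrt (by positivity), inv_mul_cancel₀ (by positivity)]
  obtain ⟨hp0, hp1, hp⟩ := hP x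
  obtain ⟨hq0, hq1, hq⟩ := hP y
  unfold saturation
  set P := (√(1 + ‖x‖ ^ 2))⁻¹
  set Q := (√(1 + ‖y‖ ^ 2))⁻¹
  refine le_of_sq_le_sq ?_ (norm_nonneg _)
  have hPQ : P * Q ≤ 1 := mul_le_one₀ hp1 hq0.le hq1
  have hxy := sq_nonneg ‖x - y‖
  rw [norm_sub_sq_real] at hxy
  rw [norm_sub_sq_real, norm_sub_sq_real, norm_smul, norm_smul, inner_smul_left, inner_smul_right,
    Real.norm_of_nonneg hp0.le, Real.norm_of_nonneg hq0.le]
  simp only [RCLike.conj_to_real]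
  -- Since `2 + ‖x‖² + ‖y‖² = P⁻² + Q⁻²`, this is `P / Q + Q / P ≥ 2`.
  have hAG : 2 ≤ (2 + ‖x‖ ^ 2 + ‖y‖ ^ 2) * (P * Q) := by
    have h1 : (2 + ‖x‖ ^ 2 + ‖y‖ ^ 2) * (P * Q) * (P * Q) = P ^ 2 + Q ^ 2 := by
      linear_combination Q ^ 2 * hp + P ^ 2 * hq
    have h2 : 0 < P * Q := mul_pos hp0 hq0
    nlinarith [sq_nonneg (P - Q)]
  have key : (P * ‖x‖) ^ 2 - 2 * (Q * (P * ⟪x, y⟫)) + (Q * ‖y‖) ^ 2 =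
      (‖x‖ ^ 2 - 2 * ⟪x, y⟫ + ‖y‖ ^ 2) * (P * Q) + (2 - (2 + ‖x‖ ^ 2 + ‖y‖ ^ 2) * (P * Q)) -
        (P - Q) ^ 2 := by
    linear_combination hp + hq
  nlinarith [sq_nonneg (P - Q), mul_le_mul_of_nonneg_left hPQ hxy]

theorem hasFDerivAt_saturation_zero :
    HasFDerivAt (saturation : H → H) (ContinuousLinearMap.id ℝ H) 0 := by
  have h : DifferentiableAt ℝ (fun x : H => (√(1 + ‖x‖ ^ 2))⁻¹) 0 := by
    refine DifferentiableAt.inv (DifferentiableAt.sqrt ?_ (by simp)) (by simp)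
    exact ((contDiff_norm_sq ℝ).differentiable one_ne_zero _).const_add _
  have := h.hasFDerivAt.smul (hasFDerivAt_id (𝕜 := ℝ) (0 : H))
  refine this.congr_fderiv ?_
  ext v
  simp

/-- A saturated linear function on the line: slope `b` near `0`, constant far away. -/
theorem exists_saturated_line {b ρ : ℝ} (hb : 0 ≤ b) (hρ : 0 < ρ) :
    ∃ (h : ℝ → ℝ) (c M : ℝ), ContDiff ℝ ∞ h ∧ (∀ s, |deriv h s| ≤ b) ∧
      (∀ s, |s| ≤ ρ → h s = b * s) ∧ (∀ s, ρ + 1 ≤ s → h s = c ∧ deriv h s = 0) ∧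
      b * ρ ≤ c ∧ ∀ s, |h s| ≤ M := by
  let q : ContDiffBump (0 : ℝ) := ⟨ρ, ρ + 1, hρ, by linarith⟩
  have hqc : Continuous q := q.continuous
  set h : ℝ → ℝ := fun s => b * ∫ x in (0 : ℝ)..s, q x with hh
  have hd : ∀ s, HasDerivAt h (b * q s) s := fun s =>
    ((hqc.integral_hasStrictDerivAt 0 s).hasDerivAt).const_mul b
  have hderiv : deriv h = fun s => b * q s := funext fun s => (hd s).deriv
  have hint : ∀ x y, IntervalIntegrable q MeasureTheory.volume x y := fun x y =>
    hqc.intervalIntegrable x y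
  have hlin : ∀ s, |s| ≤ ρ → h s = b * s := by
    intro s hs
    have : ∫ x in (0 : ℝ)..s, q x = ∫ x in (0 : ℝ)..s, (1 : ℝ) := by
      refine intervalIntegral.integral_congr fun x hx => ?_
      refine q.one_of_mem_closedBall ?_
      rw [mem_closedBall_zero_iff, Real.norm_eq_abs]
      have := abs_sub_left_of_mem_uIcc hx
      simp only [sub_zero] at this
      exact this.trans hs
    rw [hh]
    beta_reduce
    rw [this]
    simp
  have hzero : ∀ s, ρ + 1 ≤ s → q s = 0 := fun s hs => q.zero_of_le_dist (by
    rw [Real.dist_eq, sub_zero]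
    exact hs.trans (le_abs_self s))
  refine ⟨h, h (ρ + 1), b * ∫ x, q x, ?_, fun s => ?_, hlin, fun s hs => ⟨?_, ?_⟩, ?_, fun s => ?_⟩
  · rw [contDiff_infty_iff_deriv, hderiv]
    exact ⟨fun s => (hd s).differentiableAt, contDiff_const.mul q.contDiff⟩
  · rw [hderiv, abs_mul, abs_of_nonneg hb, abs_of_nonneg q.nonneg]
    exact mul_le_of_le_one_right hb q.le_one
  · rw [hh]
    beta_reduce
    rw [← intervalIntegral.integral_add_adjacent_intervals (hint 0 (ρ + 1)) (hint (ρ + 1) s)]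
    have : ∫ x in (ρ + 1)..s, q x = ∫ x in (ρ + 1)..s, (0 : ℝ) := by
      refine intervalIntegral.integral_congr fun x hx => ?_
      rw [uIcc_of_le hs] at hx
      exact hzero x hx.1
    rw [this]
    simp
  · rw [hderiv]
    simp [hzero s hs]
  · rw [← hlin ρ (abs_of_pos hρ).le, hh]
    beta_reduce
    gcongr
    rw [← intervalIntegral.integral_add_adjacent_intervals (hint 0 ρ) (hint ρ (ρ + 1))]
    have := intervalIntegral.integral_nonneg (f := q) (μ := MeasureTheory.volume)
      (by linarith : ρ ≤ ρ + 1) fun x _ => q.nonneg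
    linarith
  · rw [hh, abs_mul, abs_of_nonneg hb]
    gcongr
    refine (intervalIntegral.norm_integral_le_integral_norm_uIoc (f := q)).trans ?_
    simp only [Real.norm_eq_abs, abs_of_nonneg q.nonneg]
    exact MeasureTheory.setIntegral_le_integral q.integrable
      (Eventually.of_forall fun x => q.nonneg)

/-- Cutoff functions around `r` with a small derivative, vanishing off `[r - m, r + m]`; the
number `m` does not depend on `r`. -/
theorem exists_slow_cutoff {ε : ℝ} (hε : 0 < ε) :
    ∃ m > 0, ∀ r : ℝ, ∃ χ : ℝ → ℝ, ContDiff ℝ ∞ χ ∧ (∀ s, 0 ≤ χ s) ∧ (∀ s, χ s ≤ 1) ∧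
      (∀ᶠ s in 𝓝 r, χ s = 1) ∧ (∀ s, m ≤ |s - r| → χ s = 0) ∧ ∀ s, |deriv χ s| ≤ ε := by
  let φ : ContDiffBump (0 : ℝ) := ⟨1, 2, one_pos, one_lt_two⟩
  have hφ : ContDiff ℝ ∞ φ := φ.contDiff
  obtain ⟨D, hD⟩ := hφ.lipschitzWith_of_hasCompactSupport φ.hasCompactSupport (by simp)
  -- Dilating a fixed bump by `η` scales its derivative bound `D` down to `ε` and its outer radius
  -- `2` up to `2 / η`.
  obtain ⟨η, hη⟩ : ∃ η, η = ε / ((D : ℝ) + 1) := ⟨_, rfl⟩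
  have hη0 : 0 < η := by rw [hη]; positivity
  refine ⟨2 / η, by positivity, fun r => ⟨fun s => φ (η * (s - r)), by fun_prop,
    fun s => φ.nonneg, fun s => φ.le_one, ?_, fun s hs => ?_, fun s => ?_⟩⟩
  · have hc : ContinuousAt (fun s => η * (s - r)) r := by fun_prop
    have hb : Metric.closedBall (0 : ℝ) 1 ∈ 𝓝 (η * (r - r)) := by
      rw [sub_self, mul_zero]
      exact Metric.closedBall_mem_nhds _ one_pos
    filter_upwards [hc hb] with s hs using φ.one_of_mem_closedBall hs
  · refine φ.zero_of_le_dist ?_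
    rw [div_le_iff₀ hη0] at hs
    rwa [Real.dist_eq, sub_zero, abs_mul, abs_of_pos hη0, mul_comm]
  · have hd : HasDerivAt (fun s => φ (η * (s - r))) (deriv φ (η * (s - r)) * η) s := by
      have h1 : HasDerivAt (fun s => η * (s - r)) η s := by
        simpa using ((hasDerivAt_id s).sub_const r).const_mul η
      exact ((hφ.differentiable (by simp)).differentiableAt.hasDerivAt).comp s h1
    have h2 : |deriv φ (η * (s - r))| ≤ D := norm_deriv_le_of_lipschitz hD
    have h3 : (D : ℝ) * η ≤ ε := by
      rw [hη, ← mul_div_assoc, div_le_iff₀ (by positivity)]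
      nlinarith
    rw [hd.deriv, abs_mul, abs_of_pos hη0]
    exact (mul_le_mul_of_nonneg_right h2 hη0.le).trans h3

theorem norm_fderiv_saturation_le (x v : H) : ‖fderiv ℝ saturation x v‖ ≤ ‖v‖ := by
  have h : LipschitzWith 1 (saturation : H → H) := LipschitzWith.of_dist_le_mul fun x y => by
    simpa [dist_eq_norm] using norm_saturation_sub_le x y
  have := (fderiv ℝ saturation x).le_of_opNorm_le (norm_fderiv_le_of_lipschitz ℝ h (x₀ := x)) v
  simpa using this

/-- A bounded smooth `L`-Lipschitz map, linear with slope `b` on a segment of the line `ℝ e₀`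
around `0`, with prescribed derivatives at `0` and at a further point `r • e₀`. -/
theorem exists_nonlinearity {e₀ : H} (he₀ : ‖e₀‖ = 1) {l b L : ℝ} (hl : 0 < l) (hlb : l < b)
    (hbL : b < L) {T₀ T₁ : H →L[ℝ] H} (hT₀ : ∀ x, ‖T₀ x‖ ≤ b * ‖x‖) (hT₁ : ∀ x, ‖T₁ x‖ ≤ b * ‖x‖)
    (horth : ∀ x, ⟪e₀, T₀ x⟫ = 0) (hTe : T₀ e₀ = 0) :
    ∃ (F : H → H) (r M : ℝ), ContDiff ℝ ∞ F ∧ (∀ u v, ‖F u - F v‖ ≤ L * ‖u - v‖) ∧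
      (∀ u, ‖F u‖ ≤ M) ∧ F (r • e₀) = (l * r) • e₀ ∧ HasFDerivAt F T₁ (r • e₀) ∧
      HasFDerivAt F (T₀ + b • (innerSL ℝ e₀).smulRight e₀) 0 ∧
      ∀ s : ℝ, |s| ≤ 1 → F (s • e₀) = (b * s) • e₀ := by
  have hb : 0 < b := hl.trans hlb
  have hee : ⟪e₀, e₀⟫ = 1 := by rw [real_inner_self_eq_norm_sq, he₀, one_pow]
  have hlb' : 0 < b - l := sub_pos.2 hlb
  -- The cutoff derivative multiplies a difference of norm at most `2 * b`, so this `ε` uses exactly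
  -- the spare constant `L - b`.
  obtain ⟨ε, hε⟩ : ∃ ε, ε = (L - b) / (2 * b) := ⟨_, rfl⟩
  have hε0 : 0 < ε := by rw [hε]; exact div_pos (sub_pos.2 hbL) (by positivity)
  obtain ⟨m, hm, hcut⟩ := exists_slow_cutoff hε0
  -- The linear range is long enough that the graph of `h` meets the line `l * s` only after `h` has
  -- become constant, with room `m` for the cutoff. This needs `l < b`.
  obtain ⟨ρ, hρ⟩ : ∃ ρ, ρ = max 1 (l * (1 + m) / (b - l)) := ⟨_, rfl⟩
  have hρ1 : 1 ≤ ρ := hρ ▸ le_max_left _ _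
  have hρ2 : l * (ρ + 1 + m) ≤ b * ρ := by
    have : l * (1 + m) / (b - l) ≤ ρ := hρ ▸ le_max_right _ _
    rw [div_le_iff₀ hlb'] at this
    linarith
  obtain ⟨h, c, M, hh, hderiv, hlin, hsat, hc, hM⟩ :=
    exists_saturated_line hb.le (zero_lt_one.trans_le hρ1)
  -- This choice gives `h r = c = l * r`, the equilibrium condition on the axis.
  obtain ⟨r, hr⟩ : ∃ r, r = c / l := ⟨_, rfl⟩
  have hlr : l * r = c := by rw [hr, mul_div_cancel₀ _ hl.ne']
  have hrm : ρ + 1 ≤ r - m := by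
    have : ρ + 1 + m ≤ r := by
      rw [hr, le_div_iff₀ hl]
      linarith
    linarith
  obtain ⟨χ, hχ, hχ0, hχ1, hχr, hχz, hχd⟩ := hcut r
  have hsupp : ∀ s, s < ρ + 1 → χ s = 0 := fun s hs => hχz s (by
    rw [abs_sub_comm]
    exact le_trans (by linarith) (le_abs_self _))
  set F : H → H := fun u => h ⟪e₀, u⟫ • e₀ +
    (1 - χ ⟪e₀, u⟫) • T₀ (saturation (u - ⟪e₀, u⟫ • e₀)) +
    χ ⟪e₀, u⟫ • T₁ (saturation (u - r • e₀)) with hF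
  have hσ : ContDiff ℝ ∞ (saturation : H → H) := contDiff_saturation
  have hσd : Differentiable ℝ (saturation : H → H) := hσ.differentiable (by simp)
  have hin : ContDiff ℝ ∞ fun u : H => ⟪e₀, u⟫ := contDiff_const.inner ℝ contDiff_id
  have hFs : ContDiff ℝ ∞ F := by
    refine ContDiff.add (ContDiff.add ?_ ?_) ?_
    · exact (hh.comp hin).smul contDiff_const
    · exact (contDiff_const.sub (hχ.comp hin)).smul
        (T₀.contDiff.comp (hσ.comp (contDiff_id.sub (hin.smul contDiff_const))))
    · exact (hχ.comp hin).smul (T₁.contDiff.comp (hσ.comp (contDiff_id.sub contDiff_const)))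
  have hFd : Differentiable ℝ F := hFs.differentiable (by simp)
  have hline : ∀ u v, fderiv ℝ F u v = (deriv h ⟪e₀, u⟫ * ⟪e₀, v⟫) • e₀ +
      ((1 - χ ⟪e₀, u⟫) • T₀ (fderiv ℝ saturation (u - ⟪e₀, u⟫ • e₀) (v - ⟪e₀, v⟫ • e₀)) +
        (-(deriv χ ⟪e₀, u⟫ * ⟪e₀, v⟫)) • T₀ (saturation (u - ⟪e₀, u⟫ • e₀))) +
      (χ ⟪e₀, u⟫ • T₁ (fderiv ℝ saturation (u - r • e₀) v) +
        (deriv χ ⟪e₀, u⟫ * ⟪e₀, v⟫) • T₁ (saturation (u - r • e₀))) := by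
    intro u v
    have hγ : HasDerivAt (fun t : ℝ => u + t • v) v 0 := by
      simpa using ((hasDerivAt_id (0 : ℝ)).smul_const v).const_add u
    have hs : HasDerivAt (fun t : ℝ => ⟪e₀, u + t • v⟫) ⟪e₀, v⟫ 0 := by
      simpa using (hasDerivAt_const (0 : ℝ) e₀).inner ℝ hγ
    have hcomp : ∀ g : ℝ → ℝ, ContDiff ℝ ∞ g →
        HasDerivAt (fun t : ℝ => g ⟪e₀, u + t • v⟫) (deriv g ⟪e₀, u⟫ * ⟪e₀, v⟫) 0 := by
      intro g hg
      have := (hg.differentiable (by simp) ⟪e₀, u⟫).hasDerivAt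
      refine HasDerivAt.comp (h := fun t : ℝ => ⟪e₀, u + t • v⟫) 0 ?_ hs
      simpa using this
    have hσcomp : ∀ (T : H →L[ℝ] H) (w : ℝ → H) (w' : H), HasDerivAt w w' 0 →
        HasDerivAt (fun t => T (saturation (w t))) (T (fderiv ℝ saturation (w 0) w')) 0 :=
      fun T w w' hw =>
        T.hasFDerivAt.comp_hasDerivAt 0 ((hσd (w 0)).hasFDerivAt.comp_hasDerivAt 0 hw)
    have h1 := (hcomp h hh).smul_const e₀
    have h2 := ((hcomp χ hχ).const_sub 1).smul
      (hσcomp T₀ (fun t : ℝ => u + t • v - ⟪e₀, u + t • v⟫ • e₀) _ (hγ.sub (hs.smul_const e₀)))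
    have h3 := (hcomp χ hχ).smul (hσcomp T₁ (fun t : ℝ => u + t • v - r • e₀) _ (hγ.sub_const _))
    have h4 := (h1.add h2).add h3
    have h5 : HasDerivAt (fun t : ℝ => F (u + t • v)) (fderiv ℝ F u v) 0 := by
      refine HasFDerivAt.comp_hasDerivAt (l := F) (f := fun t : ℝ => u + t • v) 0 ?_ hγ
      simpa using (hFd u).hasFDerivAt
    simpa using h5.unique h4
  have hbound : ∀ u v, ‖fderiv ℝ F u v‖ ≤ L * ‖v‖ := by
    intro u v
    rw [hline]
    have ha : |⟪e₀, v⟫| ≤ ‖v‖ := by simpa [he₀] using abs_real_inner_le_norm e₀ v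
    set s := ⟪e₀, u⟫
    set a := ⟪e₀, v⟫
    set w := fderiv ℝ saturation (u - s • e₀) (v - a • e₀) with hw
    set z := fderiv ℝ saturation (u - r • e₀) v
    have hpyth : ‖v - a • e₀‖ ^ 2 = ‖v‖ ^ 2 - a ^ 2 := by
      rw [norm_sub_sq_real, inner_smul_right, norm_smul, he₀, real_inner_comm, Real.norm_eq_abs,
        mul_one, sq_abs]
      ring
    have hw1 : ‖w‖ ≤ ‖v - a • e₀‖ := norm_fderiv_saturation_le _ _
    have hw2 : ‖v - a • e₀‖ ≤ ‖v‖ := by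
      refine le_of_sq_le_sq ?_ (norm_nonneg v)
      rw [hpyth]
      linarith [sq_nonneg a]
    have hz : ‖z‖ ≤ ‖v‖ := norm_fderiv_saturation_le _ _
    -- The slope of `h` and the cutoff never act together. Before `ρ + 1` the `e₀` term is
    -- orthogonal to the range of `T₀`, so Pythagoras gives the constant `b` without loss;
    -- afterwards only a convex combination of `T₀` and `T₁` terms remains.
    have hmain : ‖(deriv h s * a) • e₀ + (1 - χ s) • T₀ w + χ s • T₁ z‖ ≤ b * ‖v‖ := by
      by_cases hs : s < ρ + 1
      · rw [hsupp s hs, sub_zero, one_smul, zero_smul, add_zero]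
        refine le_of_sq_le_sq ?_ (by positivity)
        rw [norm_add_sq_real, inner_smul_left, horth, norm_smul, he₀, mul_zero, mul_zero,
          add_zero, mul_one, Real.norm_eq_abs, abs_mul, mul_pow, mul_pow, sq_abs a]
        have h1 : |deriv h s| ^ 2 ≤ b ^ 2 := pow_le_pow_left₀ (abs_nonneg _) (hderiv s) 2
        have h2 : ‖T₀ w‖ ^ 2 ≤ (b * ‖v - a • e₀‖) ^ 2 :=
          pow_le_pow_left₀ (norm_nonneg _) ((hT₀ w).trans (by gcongr)) 2
        rw [mul_pow, hpyth] at h2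
        have h3 := mul_le_mul_of_nonneg_right h1 (sq_nonneg a)
        linarith
      · rw [(hsat s (not_lt.1 hs)).2, zero_mul, zero_smul, zero_add]
        have h0 : 0 ≤ 1 - χ s := sub_nonneg.2 (hχ1 s)
        refine (norm_add_le _ _).trans ?_
        rw [norm_smul, norm_smul, Real.norm_of_nonneg h0, Real.norm_of_nonneg (hχ0 s)]
        calc (1 - χ s) * ‖T₀ w‖ + χ s * ‖T₁ z‖
            ≤ (1 - χ s) * (b * ‖v‖) + χ s * (b * ‖v‖) := by
              refine add_le_add (mul_le_mul_of_nonneg_left ?_ h0)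
                (mul_le_mul_of_nonneg_left ?_ (hχ0 s))
              · exact (hT₀ w).trans (by gcongr; exact hw1.trans hw2)
              · exact (hT₁ z).trans (by gcongr)
          _ = b * ‖v‖ := by ring
    have hT : ∀ T : H →L[ℝ] H, (∀ x, ‖T x‖ ≤ b * ‖x‖) → ∀ x, ‖T (saturation x)‖ ≤ b :=
      fun T hT x => (hT _).trans (mul_le_of_le_one_right hb.le (norm_saturation_le x))
    have hrest : ‖(deriv χ s * a) • (T₁ (saturation (u - r • e₀)) -
        T₀ (saturation (u - s • e₀)))‖ ≤ (L - b) * ‖v‖ := by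
      rw [norm_smul, Real.norm_eq_abs, abs_mul]
      calc _ ≤ ε * ‖v‖ * (b + b) := by
            refine mul_le_mul (mul_le_mul (hχd s) ha (abs_nonneg _) hε0.le) ?_ (norm_nonneg _)
              (by positivity)
            exact (norm_sub_le _ _).trans (add_le_add (hT T₁ hT₁ _) (hT T₀ hT₀ _))
        _ = (L - b) * ‖v‖ := by
            rw [hε]
            field_simp
            ring
    calc _ = ‖((deriv h s * a) • e₀ + (1 - χ s) • T₀ w + χ s • T₁ z) +
          (deriv χ s * a) • (T₁ (saturation (u - r • e₀)) - T₀ (saturation (u - s • e₀)))‖ := by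
          congr 1
          rw [smul_sub, neg_smul]
          abel
      _ ≤ b * ‖v‖ + (L - b) * ‖v‖ := (norm_add_le _ _).trans (add_le_add hmain hrest)
      _ = L * ‖v‖ := by ring
  have hcont : Continuous fun u : H => ⟪e₀, u⟫ := hin.continuous
  refine ⟨F, r, M + b + b, hFs, fun u v => ?_, fun u => ?_, ?_, ?_, ?_, fun s hs => ?_⟩
  · exact convex_univ.norm_image_sub_le_of_norm_fderiv_le (𝕜 := ℝ) (fun x _ => hFd x)
      (fun x _ => ContinuousLinearMap.opNorm_le_bound _ (hb.trans hbL).le (hbound x))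
      (mem_univ v) (mem_univ u)
  · have hT : ∀ T : H →L[ℝ] H, (∀ x, ‖T x‖ ≤ b * ‖x‖) → ∀ (k : ℝ) x, 0 ≤ k → k ≤ 1 →
        ‖k • T (saturation x)‖ ≤ b := fun T hT k x hk0 hk1 => by
      rw [norm_smul, Real.norm_of_nonneg hk0]
      have := (hT (saturation x)).trans (mul_le_of_le_one_right hb.le (norm_saturation_le x))
      exact (mul_le_of_le_one_left (norm_nonneg _) hk1).trans this
    refine (norm_add_le _ _).trans (add_le_add ((norm_add_le _ _).trans (add_le_add ?_ ?_)) ?_)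
    · rw [norm_smul, he₀, mul_one]
      exact hM _
    · exact hT T₀ hT₀ _ _ (sub_nonneg.2 (hχ1 _)) (by linarith [hχ0 ⟪e₀, u⟫])
    · exact hT T₁ hT₁ _ _ (hχ0 _) (hχ1 _)
  · have hs : ⟪e₀, r • e₀⟫ = r := by rw [inner_smul_right, hee, mul_one]
    rw [hF]
    beta_reduce
    rw [hs, (hsat r (by linarith)).1, hχr.self_of_nhds, hlr]
    simp [saturation]
  · have hs : ⟪e₀, r • e₀⟫ = r := by rw [inner_smul_right, hee, mul_one]
    -- Near `r • e₀` both `h` and `χ` are constant, so only `T₁` contributes to the derivative.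
    have hev : F =ᶠ[𝓝 (r • e₀)] fun u => c • e₀ + T₁ (saturation (u - r • e₀)) := by
      have h1 := (hs ▸ hcont.tendsto (r • e₀)).eventually
        (hχr.and (lt_mem_nhds (by linarith : ρ + 1 < r)))
      filter_upwards [h1] with u hu
      rw [hF]
      beta_reduce
      rw [hu.1, (hsat _ hu.2.le).1, sub_self, zero_smul, one_smul, add_zero]
    refine HasFDerivAt.congr_of_eventuallyEq ?_ hev
    have h2 : HasFDerivAt (fun u : H => u - r • e₀) (ContinuousLinearMap.id ℝ H) (r • e₀) :=
      (hasFDerivAt_id _).sub_const _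
    have h3 : HasFDerivAt (saturation : H → H) (ContinuousLinearMap.id ℝ H) (r • e₀ - r • e₀) := by
      rw [sub_self]
      exact hasFDerivAt_saturation_zero
    have h4 := (T₁.hasFDerivAt.comp (r • e₀)
      (HasFDerivAt.comp (f := fun u : H => u - r • e₀) (r • e₀) h3 h2)).const_add (c • e₀)
    exact h4.congr_fderiv (by ext; simp)
  · have hev : F =ᶠ[𝓝 0] fun u => (b * ⟪e₀, u⟫) • e₀ + T₀ (saturation (u - ⟪e₀, u⟫ • e₀)) := by
      have h0 : Tendsto (fun u : H => |⟪e₀, u⟫|) (𝓝 0) (𝓝 0) := by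
        have := (hcont.abs).tendsto (0 : H)
        simpa using this
      filter_upwards [h0.eventually (gt_mem_nhds one_pos)] with u hu
      rw [hF]
      beta_reduce
      rw [hlin _ (hu.le.trans hρ1), hsupp _ (by linarith [le_abs_self ⟪e₀, u⟫]), sub_zero,
        one_smul, zero_smul, add_zero]
    refine HasFDerivAt.congr_of_eventuallyEq ?_ hev
    have h2 : HasFDerivAt (fun u : H => u - ⟪e₀, u⟫ • e₀)
        (ContinuousLinearMap.id ℝ H - (innerSL ℝ e₀).smulRight e₀) 0 :=
      (hasFDerivAt_id _).sub ((innerSL ℝ e₀).smulRight e₀).hasFDerivAt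
    have h3 : HasFDerivAt (saturation : H → H) (ContinuousLinearMap.id ℝ H)
        ((0 : H) - ⟪e₀, (0 : H)⟫ • e₀) := by
      rw [inner_zero_right, zero_smul, sub_self]
      exact hasFDerivAt_saturation_zero
    have h4 := T₀.hasFDerivAt.comp (0 : H)
      (HasFDerivAt.comp (f := fun u : H => u - ⟪e₀, u⟫ • e₀) (0 : H) h3 h2)
    have h5 : HasFDerivAt (fun u : H => (b * ⟪e₀, u⟫) • e₀)
        (b • (innerSL ℝ e₀).smulRight e₀) 0 := by
      have := (b • (innerSL ℝ e₀).smulRight e₀).hasFDerivAt (x := (0 : H))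
      refine this.congr_of_eventuallyEq (Eventually.of_forall fun u => ?_)
      simp [smul_smul]
    refine (h5.add h4).congr_fderiv ?_
    ext v
    simp [hTe, add_comm]
  · have hin : ⟪e₀, s • e₀⟫ = s := by rw [inner_smul_right, hee, mul_one]
    rw [hF]
    beta_reduce
    rw [hin, hlin s (hs.trans hρ1), hsupp s (by linarith [le_abs_self s])]
    simp [saturation]

/-! ### The counterexample -/

section Counterexample

variable {A : H →ₗ.[ℝ] H} {lam : ℕ → ℝ} {e : HilbertBasis ℕ ℝ H} {K : H →L[ℝ] H}
  {E : ℝ → H →L[ℝ] H} {F : H → H} {S : ℝ → H → H} {T : H →L[ℝ] H} {L b : ℝ} {p : H} {M : Set H}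

theorem IsSpectral.inner_basis (hK : IsSpectral A lam e K) (n : ℕ) (φ : A.domain) :
    ⟪e n, A φ⟫ = lam n * ⟪e n, (φ : H)⟫ := by
  rw [← hK.inverse φ, hK.diagonal, mul_inv_cancel_left₀ (hK.pos n).ne']

/-- Exponentially growing solutions on an axis along which `F` is linear near `0`. -/
theorem IsSolutionSemigroup.axis_flow (hS : IsSolutionSemigroup A F S) (hK : IsSpectral A lam e K)
    (hE : IsHeat lam e E) (hL : 0 ≤ L) (hF : ∀ u v : H, ‖F u - F v‖ ≤ L * ‖u - v‖)
    (hTe : T (e 0) = b • e 0) (hb : lam 0 ≤ b)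
    (haxis : ∀ s : ℝ, |s| ≤ 1 → F (s • e 0) = (b * s) • e 0) {s t : ℝ} (hs : |s| ≤ 1)
    (ht : 0 ≤ t) : S t ((s * Real.exp (-(b - lam 0) * t)) • e 0) = s • e 0 := by
  set a := s * Real.exp (-(b - lam 0) * t) with ha
  have hsol : IsSolution A T (a • e 0) fun r => (a * Real.exp ((b - lam 0) * r)) • e 0 := by
    refine ⟨Continuous.continuousOn (by fun_prop), by simp, fun φ r _ => ?_⟩
    have hd : HasDerivAt (fun r => Real.exp ((b - lam 0) * r))
        (Real.exp ((b - lam 0) * r) * (b - lam 0)) r := by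
      simpa using ((hasDerivAt_id r).const_mul (b - lam 0)).exp
    simp only [inner_smul_left, map_smul, hTe, hK.inner_basis, RCLike.conj_to_real]
    exact ((hd.const_mul a).mul_const _).congr_deriv (by ring)
  have hFc := continuous_of_norm_sub_le hF
  have := (hS.isMild hK hE hFc (a • e 0)).norm_sub_le hE hK.pos hL hFc T.continuous
    (hsol.isMild hK hE T.continuous) (ε := 0) (T := t) le_rfl (fun r hr0 hrt => by
      have h1 : |a * Real.exp ((b - lam 0) * r)| ≤ 1 := by
        rw [ha, mul_assoc, ← Real.exp_add, abs_mul, abs_of_pos (Real.exp_pos _)]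
        refine mul_le_one₀ hs (Real.exp_pos _).le (Real.exp_le_one_iff.2 ?_)
        nlinarith
      have h2 : T ((a * Real.exp ((b - lam 0) * r)) • e 0) =
          F ((a * Real.exp ((b - lam 0) * r)) • e 0) := by
        rw [map_smul, hTe, haxis _ h1, smul_smul, mul_comm]
      rw [h2, zero_add]
      exact hF _ _) ht le_rfl
  rw [sub_self, norm_zero, zero_mul, zero_add, zero_mul, norm_le_zero_iff, sub_eq_zero] at this
  rw [this, ha, mul_assoc, ← Real.exp_add, neg_mul, neg_add_cancel, Real.exp_zero, mul_one]

/-- The tangent space at an equilibrium is invariant under the linearized flow. -/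
theorem exists_invariant_tangentSpace (hS : IsSolutionSemigroup A F S)
    (hK : IsSpectral A lam e K) (hE : IsHeat lam e E) (hL : 0 ≤ L)
    (hF : ∀ u v : H, ‖F u - F v‖ ≤ L * ‖u - v‖)
    (hp : ∀ φ : A.domain, ⟪F p, (φ : H)⟫ = ⟪p, A φ⟫) (hT : HasFDerivAt F T p) {n : ℕ}
    (hM : IsC1Submanifold n M) (hinv : IsInvariantUnder S M) (hpM : p ∈ M)
    {G : ℝ → H →L[ℝ] H} (hG : IsSolutionSemigroup A T fun t x => G t x) {t : ℝ} (ht : 0 ≤ t) :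
    ∃ V : Submodule ℝ H, FiniteDimensional ℝ V ∧ Module.finrank ℝ V = n ∧
      (∀ v, v ∈ V ↔ IsTangentVector M p v) ∧ ∀ v ∈ V, G t v ∈ V := by
  obtain ⟨V, hfin, hrank, hV⟩ := hM.exists_tangentSpace hpM
  refine ⟨V, hfin, hrank, hV, fun v hv => (hV _).2 ?_⟩
  exact ((hV v).1 hv).image (hS.hasFDerivAt hK hE hL hF hp hT hG ht)
    (hS.eq_self_of_equilibrium hp ht) (hinv t ht)

theorem even_of_isC1Submanifold (hS : IsSolutionSemigroup A F S)
    (hK : IsSpectral A lam e K) (hE : IsHeat lam e E) (hL : 0 ≤ L)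
    (hF : ∀ u v : H, ‖F u - F v‖ ≤ L * ‖u - v‖)
    (hp : ∀ φ : A.domain, ⟪F p, (φ : H)⟫ = ⟪p, A φ⟫) (hT : HasFDerivAt F T p) {n : ℕ}
    (hM : IsC1Submanifold n M) (hinv : IsInvariantUnder S M) (hpM : p ∈ M) (hb : 0 < b)
    (hgap : ∀ n, |lam n - lam (n + 1)| / 2 < b)
    (hrot : ∀ k x, ⟪e (2 * k), T x⟫ = -b * ⟪e (2 * k + 1), x⟫ ∧
      ⟪e (2 * k + 1), T x⟫ = b * ⟪e (2 * k), x⟫) : Even n := by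
  obtain ⟨G, hG⟩ := exists_linearFlow hK hE T
  obtain ⟨V, hfin, rfl, -, hGV⟩ := exists_invariant_tangentSpace hS hK hE hL hF hp hT hM hinv hpM
    hG (t := 1 / b) (by positivity)
  refine even_finrank_of_forall_ne hGV fun μ v _ hv => ext_basis e fun m => ?_
  have hpair := fun k => inner_eq_zero_of_eigenvector hK hG (hgap (2 * k)) (fun x => (hrot k x).1)
    (fun x => (hrot k x).2) hv
  rw [inner_zero_right]
  rcases Nat.even_or_odd' m with ⟨k, rfl | rfl⟩
  · exact (hpair k).1
  · exact (hpair k).2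

/-- The line through `e 0` lies in the tangent space `V`, and its orthogonal complement in `V` is
invariant under the linearized flow. On that complement the coordinate along `e 0` vanishes and the
rotating pairs exclude real eigenvalues, so `V` has one dimension more than an even-dimensional
space. -/
theorem odd_of_isC1Submanifold (hS : IsSolutionSemigroup A F S)
    (hK : IsSpectral A lam e K) (hE : IsHeat lam e E) (hL : 0 ≤ L)
    (hF : ∀ u v : H, ‖F u - F v‖ ≤ L * ‖u - v‖)
    (hp : ∀ φ : A.domain, ⟪F p, (φ : H)⟫ = ⟪p, A φ⟫) (hT : HasFDerivAt F T p) {n : ℕ}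
    (hM : IsC1Submanifold n M) (hinv : IsInvariantUnder S M) (hpM : p ∈ M) (hb : 0 < b)
    (hgap : ∀ n, |lam n - lam (n + 1)| / 2 < b) (htan : IsTangentVector M p (e 0))
    (hT0 : ∀ x, ⟪e 0, T x⟫ = b * ⟪e 0, x⟫)
    (hrot : ∀ k x, ⟪e (2 * k + 1), T x⟫ = -b * ⟪e (2 * k + 2), x⟫ ∧
      ⟪e (2 * k + 2), T x⟫ = b * ⟪e (2 * k + 1), x⟫) : Odd n := by
  obtain ⟨G, hG⟩ := exists_linearFlow hK hE T
  have ht : 0 ≤ 1 / b := by positivity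
  obtain ⟨V, hfin, rfl, hV, hGV⟩ := exists_invariant_tangentSpace hS hK hE hL hF hp hT hM hinv hpM
    hG ht
  have heV : e 0 ∈ V := (hV _).2 htan
  have he0 : e 0 ≠ 0 := e.orthonormal.ne_zero 0
  have hrank := Submodule.finrank_add_inf_finrank_orthogonal
    ((Submodule.span_singleton_le_iff_mem (e 0) V).2 heV)
  rw [finrank_span_singleton he0] at hrank
  have : FiniteDimensional ℝ ((Submodule.span ℝ {e 0})ᗮ ⊓ V : Submodule ℝ H) :=
    Submodule.finiteDimensional_of_le inf_le_right
  have heven : Even (Module.finrank ℝ ((Submodule.span ℝ {e 0})ᗮ ⊓ V : Submodule ℝ H)) := by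
    refine even_finrank_of_forall_ne (G := G (1 / b)) (fun v hv => ⟨?_, hGV v hv.2⟩)
      fun μ v hvV hv => ext_basis e fun m => ?_
    · have := hv.1
      rw [SetLike.mem_coe, Submodule.mem_orthogonal_singleton_iff_inner_right] at this ⊢
      exact inner_flow_eq_zero hK hG hT0 this ht
    · have hpair := fun k => inner_eq_zero_of_eigenvector hK hG (hgap (2 * k + 1))
        (fun x => (hrot k x).1) (fun x => (hrot k x).2) hv
      rw [inner_zero_right]
      rcases Nat.even_or_odd' m with ⟨k, rfl | rfl⟩
      · rcases Nat.eq_zero_or_pos k with rfl | hk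
        · exact Submodule.mem_orthogonal_singleton_iff_inner_right.1 hvV.1
        · obtain ⟨k, rfl⟩ : ∃ m, k = m + 1 := ⟨k - 1, by omega⟩
          exact (hpair k).2
      · exact (hpair k).1
  rw [← hrank, add_comm]
  exact heven.add_one

end Counterexample

end AbstractParabolic

open AbstractParabolic

theorem theorem1p1 {H : Type*} [NormedAddCommGroup H] [InnerProductSpace ℝ H] [CompleteSpace H]
    (A : H →ₗ.[ℝ] H) (hA : IsPositiveWithCompactInverse A)
    (lam : ℕ → ℝ) (e : HilbertBasis ℕ ℝ H) (he : IsOrderedEigenbasis A lam e)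
    (hL₀ : BddAbove (Set.range fun n : ℕ => lam (n + 1) - lam n))
    (L : ℝ) (hL : max ((⨆ n : ℕ, (lam (n + 1) - lam n)) / 2) (lam 0) < L) :
    ∃ F : H → H, ContDiff ℝ ∞ F ∧
      (∀ u v : H, ‖F u - F v‖ ≤ L * ‖u - v‖) ∧
      ∃ S : ℝ → H → H, IsSolutionSemigroup A F S ∧
        ∃ 𝒜 : Set H, IsGlobalAttractor S 𝒜 ∧
          ¬ ∃ (n : ℕ) (M : Set H), IsC1Submanifold n M ∧ IsInvariantUnder S M ∧ 𝒜 ⊆ M := by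
  obtain ⟨K, hK⟩ := exists_isSpectral hA he
  obtain ⟨E, hE⟩ := exists_isHeat e hK.pos
  obtain ⟨b, hb, hbL⟩ := exists_between hL
  have hlb : lam 0 < b := (le_max_right _ _).trans_lt hb
  have hb0 : 0 < b := (hK.pos 0).trans hlb
  have hL0 : 0 < L := hb0.trans hbL
  have hgap : ∀ n, |lam n - lam (n + 1)| / 2 < b := fun n => by
    have h1 : lam (n + 1) - lam n ≤ ⨆ n : ℕ, (lam (n + 1) - lam n) := le_ciSup hL₀ n
    have h2 := (le_max_left _ _).trans_lt hb
    rw [abs_sub_comm, abs_of_nonneg (sub_nonneg.2 (hK.monotone (Nat.le_succ n)))]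
    linarith
  obtain ⟨T₁, hT₁, hrot₁⟩ := exists_rotation_even e hb0
  obtain ⟨T₀, hT₀, horth, hTe, hrot₀⟩ := exists_rotation_odd e hb0
  have hee : ⟪e 0, e 0⟫ = 1 := by
    rw [real_inner_self_eq_norm_sq, e.orthonormal.1 0, one_pow]
  obtain ⟨F, r, C, hFs, hF, hC, hFr, hFd₁, hFd₀, haxis⟩ :=
    exists_nonlinearity (e.orthonormal.1 0) (hK.pos 0) hlb hbL hT₀ hT₁ horth hTe
  obtain ⟨S, hS⟩ := exists_isSolutionSemigroup hK hE hL0 hF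
  obtain ⟨𝒜, h𝒜⟩ := hS.exists_isGlobalAttractor hK hE hL0.le hF hC
  refine ⟨F, hFs, hF, S, hS, 𝒜, h𝒜, ?_⟩
  rintro ⟨n, M, hM, hinv, hsub⟩
  set T := T₀ + b • (innerSL ℝ (e 0)).smulRight (e 0) with hT
  have hTx : ∀ x, T x = T₀ x + (b * ⟪e 0, x⟫) • e 0 := fun x => by simp [hT, smul_smul]
  have hTe0 : T (e 0) = b • e 0 := by rw [hTx, hTe, hee, zero_add, mul_one]
  have hTj : ∀ j ≠ 0, ∀ x, ⟪e j, T x⟫ = ⟪e j, T₀ x⟫ := fun j hj x => by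
    rw [hTx, inner_add_right, inner_smul_right, e.orthonormal.2 hj, mul_zero, add_zero]
  have hp₁ : ∀ φ : A.domain, ⟪F (r • e 0), (φ : H)⟫ = ⟪r • e 0, A φ⟫ := fun φ => by
    rw [hFr, inner_smul_left, inner_smul_left, hK.inner_basis]
    simp only [RCLike.conj_to_real]
    ring
  have hF0 : F 0 = 0 := by simpa using haxis 0 (by simp)
  have hp₀ : ∀ φ : A.domain, ⟪F 0, (φ : H)⟫ = ⟪(0 : H), A φ⟫ := fun φ => by
    rw [hF0, inner_zero_left, inner_zero_left]
  have hmem₁ : r • e 0 ∈ 𝒜 := h𝒜.mem_of_forall_mem_image Bornology.isBounded_singleton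
    fun t ht => ⟨_, rfl, hS.eq_self_of_equilibrium hp₁ ht⟩
  -- Running the unstable axis backwards, `s • e 0` is reached at time `t` from `(s * exp (-(b - lam
  -- 0) * t)) • e 0`, which stays in the unit ball.
  have hmem : ∀ s : ℝ, |s| ≤ 1 → s • e 0 ∈ 𝒜 := fun s hs =>
    h𝒜.mem_of_forall_mem_image (Metric.isBounded_closedBall (x := (0 : H)) (r := 1)) fun t ht =>
      ⟨_, by
        rw [mem_closedBall_zero_iff, norm_smul, e.orthonormal.1 0, mul_one, Real.norm_eq_abs,
          abs_mul, abs_of_pos (Real.exp_pos _)]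
        exact mul_le_one₀ hs (Real.exp_pos _).le (Real.exp_le_one_iff.2 (by nlinarith)),
        hS.axis_flow hK hE hL0.le hF hTe0 hlb.le haxis hs ht⟩
  have hmem₀ : (0 : H) ∈ 𝒜 := by simpa using hmem 0 (by simp)
  have htan : IsTangentVector M 0 (e 0) := by
    refine ⟨fun s => s • e 0, by simp, ?_, ?_⟩
    · filter_upwards [Ioo_mem_nhdsGT (zero_lt_one' ℝ)] with s hs
      exact hsub (hmem s (abs_le.2 ⟨by linarith [hs.1], hs.2.le⟩))
    · simpa using ((hasDerivAt_id (0 : ℝ)).smul_const (e 0)).hasDerivWithinAt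
  have heven := even_of_isC1Submanifold hS hK hE hL0.le hF hp₁ hFd₁ hM hinv (hsub hmem₁) hb0 hgap
    hrot₁
  have hodd := odd_of_isC1Submanifold hS hK hE hL0.le hF hp₀ hFd₀ hM hinv (hsub hmem₀) hb0 hgap
    htan (fun x => by
      rw [hTx, inner_add_right, horth, inner_smul_right, hee, zero_add, mul_one]) fun k x => by
      rw [hTj _ (by omega), hTj _ (by omega)]
      exact hrot₀ k x
  exact Nat.not_even_iff_odd.2 hodd heven
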